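/- **Setting.** Let $\mathbb N=\{1,2,\dots\}$. For a Borel probability measure $P$ on $[0,1]^d\times\{-1,1\}$ let $P_X$ be its marginal on $[0,1]^d$ and $\eta_P(x)=P(\{1\}\mid x)$ the conditional class probability. Put $\operatorname{sgn}(t)=1$ for $t\ge 0$ and $-1$ otherwise, $\mathcal R_P(f)=P\{(x,y):\operatorname{sgn}(f(x))\ne y\}$, and $\mathcal E_P(f)=\mathcal R_P(f)-\inf_g\mathcal R_P(g)$, the infimum being over all Borel measurable $g:[0,1]^d\to\mathbb R$. For $\beta,r>0$, $\mathcal B^\beta_r([0,1]^m)$ is the set of continuous $g:[0,1]^m\to\mathbb R$ that are $\lceil\beta\rceil-1$ times continuously differentiable on $(0,1)^m$, with all partial derivatives up to that order uniformly continuous there, and with $$\max_{|u|<\beta}\ \sup_{x\in(0,1)^m}|D^ug(x)|+\max_{|u|=\lceil\beta\rceil-1}\ \sup_{x\ne z\in(0,1)^m}\frac{|D^ug(x)-D^ug(z)|}{\|x-z\|_2^{\beta+1-\lceil\beta\rceil}}\le r .$$ $\mathcal G^{\mathbf H}_d(d_*,\beta,r)$ is the set of functions $x\mapsto g((x_i)_{i\in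 I})$ on $[0,1]^d$ with $I\subset\{1,\dots,d\}$, $\#I=d_*$, $g\in\mathcal B^\beta_r([0,1]^{d_*})$. $\mathcal G^{\mathbf{CH}}_d(q,K,d_*,\beta,r)$ is the set of compositions $h_q\circ\cdots\circ h_0$ with $h_0$ defined on $[0,1]^d$, $h_i$ defined on $[0,1]^K$ for $0<i\le q$, $h_i$ having values in $[0,1]^K$ for $i<q$ and $h_q$ in $\mathbb R$, such that every component function of $h_0$ lies in $\mathcal G^{\mathbf H}_d(d_*,\beta,r)$ and every component function of $h_i$, $0<i\le q$, lies in $\mathcal G^{\mathbf H}_K(d_*,\beta,r)$. $\mathcal H^{d,\beta,r,\Lambda}_{q,K,d_*}$ is the set of all laws $P_{\eta,\mathscr Q}$ of a pair $(X,Y)$ with $X\sim\mathscr Q$ and $Y=1$ with conditional probability $\eta(X)$, $Y=-1$ otherwise, where $\eta\in\mathcal G^{\mathbf{CH}}_d(q,K,d_*,\beta,r)$ takes values in $[0,1]$ and $\mathscr Q$ is a probability measure on $[0,1]^d$ having a $[0,\Lambda]$-valued Lebesgue density. $\mathcal T^{d,s}_{\alpha,\tau}$ is the set of all $P$ satisfying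 the Tsybakov noise condition $$P_X\{x:|2\eta_P(x)-1|\le t\}\le\alpha\, t^s\qquad\text{for all real } t \text{ with } 0<t\le\tau,$$ where $t^\infty$ is $0$, $1$, $\infty$ for $t<1$, $t=1$, $t>1$. An estimator $\hat f_n$ maps a sample in $([0,1]^d\times\{-1,1\})^n$ to a Borel measurable function $[0,1]^d\to\mathbb R$, in such a way that $\mathcal E_P(\hat f_n)$ is a measurable function of the sample for every $P$. **Theorem.** Let $q\in\mathbb N\cup\{0\}$, $d,d_*,K\in\mathbb N$, $\alpha\in(0,\infty)$, $\tau\in(0,\infty]$, $s\in[0,\infty]$, $\beta\in(0,\infty)$, $\Lambda\in(1,\infty)$. Suppose $d_*q\le Kq$, $d_*\le d$, and that it is not the case that both $\alpha<1$ and $\tau\ge 1$. Then there are constants $c_7\in(0,\infty)$ depending only on $(\beta,\Lambda)$, $c_8\in(0,\infty)$ depending only on $(d_*,\beta,s,q)$, and $c_9\in(0,\infty)$ depending only on $(d_*,\beta,s,q,\Lambda)$ such that, for all $r\in[c_7,\infty)$ and all $n\in\mathbb N$ with $n>c_9$, $$\inf_{\hat f_n}\ \sup_{P\in\mathcal H^{d,\beta,r,\Lambda}_{q,K,d_*}\cap\mathcal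 T^{d,s}_{\alpha,\tau}}\mathbf E_{P^{\otimes n}}\big[\mathcal E_P(\hat f_n)\big]\ \ge\ \max\Big\{\tfrac1{32}\mathbf 1_{\{s=\infty\}},\ \min\big\{\alpha,\tfrac{\Lambda-1}{256\Lambda}\big\}\,c_8\Big\}\cdot\Big(\frac1n\Big)^{\frac{\beta(1\wedge\beta)^q}{\frac{d_*}{s+1}+\left(1+\frac1{s+1}\right)\beta(1\wedge\beta)^q}},$$ where the infimum is over all estimators based on an i.i.d. sample of size $n$ from $P$, and $\frac1{s+1}=\frac{d_*}{s+1}=0$ for $s=\infty$. -/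

import Mathlib

open MeasureTheory
open scoped ENNReal

noncomputable section

namespace BinClass

/-! ### Inputs, labels, risk -/

/-- The unit cube `[0,1]^d`. Its canonical measure `volume` is the product of the Lebesgue
measures on `[0,1]`, i.e. Lebesgue measure on the cube. -/
abbrev Cube (d : ℕ) : Type := Fin d → unitInterval

/-- The label space `{-1, 1}`. -/
abbrev Label : Type := ({-1, 1} : Set ℤ)

/-- The label `1`. -/
def lpos : Label := ⟨1, by simp⟩

/-- The label `-1`. -/
def lneg : Label := ⟨-1, by simp⟩

instance instNonemptyLabel : Nonempty Label := ⟨lpos⟩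

/-- The sign function with `sgn 0 = 1`. -/
def sgn (t : ℝ) : Label := if 0 ≤ t then lpos else lneg

/-- The 0-1 risk `P {(x, y) | sgn (f x) ≠ y}`. -/
def risk {d : ℕ} (P : ProbabilityMeasure (Cube d × Label)) (f : Cube d → ℝ) : ℝ :=
  (P : Measure (Cube d × Label)).real {z | sgn (f z.1) ≠ z.2}

/-- The excess 0-1 risk: the infimum runs over all Borel measurable functions. -/
def excessRisk {d : ℕ} (P : ProbabilityMeasure (Cube d × Label)) (f : Cube d → ℝ) : ℝ :=
  risk P f - ⨅ g : {g : Cube d → ℝ // Measurable g}, risk P g.1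

/-- An estimator based on `n` observations: a map from samples to measurable functions on the
cube, subject only to the measurability that makes the expected excess risk meaningful.
Every map for which `(z, x) ↦ toFun z x` is jointly measurable is of this kind. -/
structure Estimator (d n : ℕ) where
  /-- The function produced from the sample. -/
  toFun : (Fin n → Cube d × Label) → Cube d → ℝ
  measurable_toFun : ∀ z, Measurable (toFun z)
  measurable_excessRisk : ∀ P : ProbabilityMeasure (Cube d × Label),
    Measurable fun z => excessRisk P (toFun z)

/-- The expected excess 0-1 risk of an estimator under an i.i.d. sample from `P`
(the excess risk is nonnegative, so the expectation is taken in `[0,∞]`). -/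
def expectedExcessRisk {d n : ℕ} (P : ProbabilityMeasure (Cube d × Label))
    (f : Estimator d n) : ℝ≥0∞ :=
  ∫⁻ z, ENNReal.ofReal (excessRisk P (f.toFun z))
    ∂(Measure.pi fun _ : Fin n => (P : Measure (Cube d × Label)))

/-- The minimax expected excess 0-1 risk over a class `S` of distributions. -/
def minimaxRisk (d n : ℕ) (S : Set (ProbabilityMeasure (Cube d × Label))) : ℝ≥0∞ :=
  ⨅ f : Estimator d n, ⨆ P ∈ S, expectedExcessRisk P f

/-! ### The noise condition -/

/-- The power `t ^ s` for real `t > 0` and `s ∈ [0,∞]`, where `t ^ ∞` is `0`, `1` or `∞`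
according as `t < 1`, `t = 1` or `t > 1`. -/
def powTop (t : ℝ) (s : ℝ≥0∞) : ℝ≥0∞ :=
  if s = ⊤ then (if t < 1 then 0 else if t = 1 then 1 else ⊤)
  else ENNReal.ofReal (t ^ s.toReal)

/-- The conditional class probability `η_P(x) = P({1} | x)`, through the regular conditional
distribution of the label given the input. -/
def condProb {d : ℕ} (P : ProbabilityMeasure (Cube d × Label)) (x : Cube d) : ℝ :=
  ((P : Measure (Cube d × Label)).condKernel x).real {lpos}

/-- The distributions satisfying the Tsybakov noise condition
`P_X {x | |2 η_P(x) - 1| ≤ t} ≤ α t ^ s` for all real `t` with `0 < t ≤ τ`. -/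
def noiseClass (d : ℕ) (s : ℝ≥0∞) (α : ℝ) (τ : ℝ≥0∞) :
    Set (ProbabilityMeasure (Cube d × Label)) :=
  {P | ∀ t : ℝ, 0 < t → ENNReal.ofReal t ≤ τ →
    (P : Measure (Cube d × Label)).fst {x | |2 * condProb P x - 1| ≤ t} ≤
      ENNReal.ofReal α * powTop t s}

/-! ### Hölder balls and compositional functions -/

/-- The closed cube `[0,1]^m` in Euclidean space. -/
def closedCube (m : ℕ) : Set (EuclideanSpace ℝ (Fin m)) := {x | ∀ i, x i ∈ Set.Icc (0 : ℝ) 1}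

/-- The open cube `(0,1)^m`, the interior of the closed one. -/
def openCube (m : ℕ) : Set (EuclideanSpace ℝ (Fin m)) := {x | ∀ i, x i ∈ Set.Ioo (0 : ℝ) 1}

/-- The partial derivative `∂_{i_1} ⋯ ∂_{i_k} G` at `x`. As `i` runs over all sequences of length
`k`, these are the derivatives `D^u G` over the multi-indices `u` of order `k`. -/
def partialDeriv {m k : ℕ} (G : EuclideanSpace ℝ (Fin m) → ℝ) (i : Fin k → Fin m)
    (x : EuclideanSpace ℝ (Fin m)) : ℝ :=
  iteratedFDeriv ℝ k G x fun j => EuclideanSpace.single (i j) (1 : ℝ)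

/-- The Hölder-`β` norm on the cube, computed on its interior: the largest supremum norm of a
partial derivative of order `< β`, plus the largest Hölder seminorm, with exponent
`β + 1 - ⌈β⌉`, of a partial derivative of order `⌈β⌉ - 1`. -/
def holderNorm (m : ℕ) (β : ℝ) (G : EuclideanSpace ℝ (Fin m) → ℝ) : ℝ≥0∞ :=
  (⨆ (k : ℕ) (_ : (k : ℝ) < β) (i : Fin k → Fin m) (x ∈ openCube m),
      ENNReal.ofReal |partialDeriv G i x|) +
  ⨆ (i : Fin (⌈β⌉₊ - 1) → Fin m) (x ∈ openCube m) (z ∈ openCube m) (_ : x ≠ z),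
      ENNReal.ofReal
        (|partialDeriv G i x - partialDeriv G i z| / ‖x - z‖ ^ (β + 1 - (⌈β⌉₊ : ℝ)))

/-- The Hölder ball of radius `r` on `[0,1]^m`: the function is continuous on the cube, it is
`⌈β⌉ - 1` times continuously differentiable in the interior with all partial derivatives up to
that order uniformly continuous there, and its Hölder-`β` norm is at most `r`. A function on the
cube is represented by a function `G` on the whole space that agrees with it on the cube; the
values of `G` off the cube play no role. -/
def holderBall (m : ℕ) (β r : ℝ) : Set (Cube m → ℝ) :=
  {g | ∃ G : EuclideanSpace ℝ (Fin m) → ℝ,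
    (∀ x : Cube m, g x = G (WithLp.toLp 2 fun i => (x i : ℝ))) ∧
    ContinuousOn G (closedCube m) ∧
    ContDiffOn ℝ ((⌈β⌉₊ - 1 : ℕ) : ℕ∞) G (openCube m) ∧
    (∀ k : ℕ, k ≤ ⌈β⌉₊ - 1 → ∀ i : Fin k → Fin m,
      UniformContinuousOn (partialDeriv G i) (openCube m)) ∧
    holderNorm m β G ≤ ENNReal.ofReal r}

/-- Functions on `[0,1]^d` that are a function in the Hölder ball on `[0,1]^dstar`, applied to
`dstar` of the `d` coordinates (taken in increasing order). -/
def sparseHolder (d dstar : ℕ) (β r : ℝ) : Set (Cube d → ℝ) :=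
  {f | ∃ (I : Fin dstar ↪o Fin d) (g : Cube dstar → ℝ), g ∈ holderBall dstar β r ∧
    ∀ x, f x = g fun j => x (I j)}

/-- The compositional class of functions `h_q ∘ ⋯ ∘ h_0` on `[0,1]^d`, where
`h_0 : [0,1]^d → [0,1]^K`, `h_i : [0,1]^K → [0,1]^K` for `0 < i < q` and `h_q : [0,1]^K → ℝ`
(just `h_0 : [0,1]^d → ℝ` if `q = 0`), all of whose component functions are Hölder functions of
`dstar` of their variables. The recursion splits off the innermost function `h_0`. -/
def compClass (K dstar : ℕ) (β r : ℝ) : (q d : ℕ) → Set (Cube d → ℝ)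
  | 0, d => sparseHolder d dstar β r
  | q + 1, d => {f | ∃ (h : Cube d → Cube K) (g : Cube K → ℝ),
      (∀ j, (fun x => (h x j : ℝ)) ∈ sparseHolder d dstar β r) ∧
      g ∈ compClass K dstar β r q K ∧ f = g ∘ h}

/-! ### The class of distributions -/

/-- The probability measures on the cube with a `[0,Λ]`-valued Lebesgue density. -/
def boundedDensity (d : ℕ) (Λ : ℝ) : Set (Measure (Cube d)) :=
  {Q | IsProbabilityMeasure Q ∧ ∃ f : Cube d → ℝ, Measurable f ∧
    (∀ x, f x ∈ Set.Icc (0 : ℝ) Λ) ∧ Q = volume.withDensity fun x => ENNReal.ofReal (f x)}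

/-- The joint distribution `P_{η,Q}` of an input `X ∼ Q` and a label which, given `X = x`, is `1`
with probability `η x` and `-1` with probability `1 - η x`. -/
def jointLaw {d : ℕ} (η : Cube d → ℝ) (Q : Measure (Cube d)) : Measure (Cube d × Label) :=
  (Q.withDensity fun x => ENNReal.ofReal (η x)).map (fun x => (x, lpos)) +
  (Q.withDensity fun x => ENNReal.ofReal (1 - η x)).map (fun x => (x, lneg))

/-- The class of all `P_{η,Q}` with `η` compositional and `[0,1]`-valued and `Q` having a density
bounded by `Λ`. -/
def compDistr (d q K dstar : ℕ) (β r Λ : ℝ) : Set (ProbabilityMeasure (Cube d × Label)) :=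
  {P | ∃ (η : Cube d → ℝ) (Q : Measure (Cube d)), η ∈ compClass K dstar β r q d ∧
    Measurable η ∧ (∀ x, η x ∈ Set.Icc (0 : ℝ) 1) ∧ Q ∈ boundedDensity d Λ ∧
    (P : Measure (Cube d × Label)) = jointLaw η Q}

/-! ### The rate -/

/-- The exponent `β (1 ∧ β)^q / (dstar / (s+1) + (1 + 1/(s+1)) β (1 ∧ β)^q)`,
with `1/(s+1) = 0` for `s = ∞`. -/
def rateExponent (q dstar : ℕ) (β : ℝ) (s : ℝ≥0∞) : ℝ :=
  (β * min 1 β ^ q) /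
    (dstar * ((s + 1)⁻¹).toReal + (1 + ((s + 1)⁻¹).toReal) * (β * min 1 β ^ q))

end BinClass

end

open BinClass

/-! ### Product measures and the Hellinger affinity -/

namespace BinClass

/-! The bound is Assouad's: a family of laws is indexed by bits, all with the same input marginal
`Q`, such that each bit governs the favoured label on one small cell and is hard to learn from `n`
observations.

With `ε` the margin, `η` equals `1/2 ± ε/2` on cell `i` according to bit `i`, and equals `1` on a
set `E` that carries the rest of `Q`. Predicting the wrong sign costs `ε` per unit of mass, so with
cells of mass `w` the excess risk is at least `w ε` times the sum of the relative errors on the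
cells. Flipping one bit changes the law only on one cell, and the Hellinger affinity of the two laws
is at least `1 - w ε²`. If `w ε² ≤ 1/(2n)`, the `n`-fold affinity stays bounded below and no test
recovers the bit (`hellinger_affinity_le`, `le_affinity`). Averaging over all bits gives the bound
(number of cells) `* w * ε / 16` (`le_minimaxRisk`).

Margins are `ε` or `1` almost surely, so for finite `s` the noise condition reduces to total cell
mass at most `α ε^s` (`mem_noiseClass`). The density bound leaves room because `Λ > 1`: with `a =
(Λ-1)/(2Λ)` the set `E = {x₀ ≥ 2a}` has volume `1/Λ` and can absorb all the remaining mass, while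
the cells live in `{x₀ ≤ a}`.

The composition supplies the factor `(1 ∧ β)^q`. The innermost function carries smooth bumps of
width `1/M` and height of order `M^(-β)`. Each outer layer applies the signed power of exponent `1 ∧
β`, which lies in the Hölder ball, keeps `1/2` and `1` fixed and raises the margin to that power
(`iterate_signedPow_half_add`). Hence `ε` is of order `M^(-b)` with `b = β (1 ∧ β)^q`. With about
`M^dstar` cells of total mass of order `ε^s`, the condition `w ε² ≲ 1/n` leads to `M` of order
`n^(1/D)`, `D = dstar + b (2 + s)`, and the bound is of order `ε^(s+1)`, which is the rate. For `s =
∞` the margin must be `1`; a single cell of mass `1/(2n)` yields `1/(32n)`. -/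

theorem lintegral_pi_prod {Ω : Type*} [MeasurableSpace Ω] (μ : Measure Ω) [SigmaFinite μ] :
    ∀ (n : ℕ) (g : Fin n → Ω → ℝ≥0∞), (∀ i, Measurable (g i)) →
      ∫⁻ z, ∏ i, g i (z i) ∂(Measure.pi fun _ : Fin n => μ) = ∏ i, ∫⁻ x, g i x ∂μ
  | 0, g, _ => by simp
  | n + 1, g, hg => by
    have h := (measurePreserving_piFinSuccAbove (fun _ : Fin (n + 1) => μ) 0)
    have hm : Measurable fun y : Ω × (Fin n → Ω) => g 0 y.1 * ∏ i, g (Fin.succ i) (y.2 i) := by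
      have h0 := hg 0
      refine (h0.comp measurable_fst).mul (Finset.measurable_prod _ fun i _ => ?_)
      exact (hg i.succ).comp ((measurable_pi_apply i).comp measurable_snd)
    have := h.lintegral_comp hm
    rw [Fin.prod_univ_succ, ← lintegral_pi_prod μ n (fun i => g i.succ) (fun i => hg _),
      ← lintegral_prod_mul (hg 0).aemeasurable
        (Finset.measurable_prod _ fun i _ => (hg i.succ).comp (measurable_pi_apply i)).aemeasurable,
      ← this]
    refine lintegral_congr fun z => ?_
    simp [Fin.prod_univ_succ, MeasurableEquiv.piFinSuccAbove, Fin.insertNthEquiv, Fin.tail]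

theorem pi_withDensity {Ω : Type*} [MeasurableSpace Ω] (μ : Measure Ω) [SigmaFinite μ] (n : ℕ)
    (g : Ω → ℝ≥0∞) (hg : Measurable g) [SigmaFinite (μ.withDensity g)] :
    Measure.pi (fun _ : Fin n => μ.withDensity g) =
      (Measure.pi fun _ : Fin n => μ).withDensity fun z => ∏ i, g (z i) := by
  refine Measure.pi_eq (μ := fun _ : Fin n => μ.withDensity g) fun s hs => ?_
  rw [withDensity_apply _ (MeasurableSet.univ_pi hs),
    ← lintegral_indicator (MeasurableSet.univ_pi hs)]
  have : ∀ i, μ.withDensity g (s i) = ∫⁻ x, (s i).indicator g x ∂μ := fun i => by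
    rw [withDensity_apply _ (hs i), lintegral_indicator (hs i)]
  simp_rw [this]
  rw [← lintegral_pi_prod μ n (fun i => (s i).indicator g) (fun i => hg.indicator (hs i))]
  refine lintegral_congr fun z => ?_
  by_cases hz : z ∈ Set.univ.pi s
  · rw [Set.indicator_of_mem hz]
    exact Finset.prod_congr rfl fun i _ => (Set.indicator_of_mem (hz i trivial) _).symm
  · rw [Set.indicator_of_notMem hz]
    simp only [Set.mem_pi, Set.mem_univ, true_imp_iff, not_forall] at hz
    obtain ⟨i, hi⟩ := hz
    exact (Finset.prod_eq_zero (Finset.mem_univ i) (Set.indicator_of_notMem hi _)).symm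

/-- A convex combination is at least the smaller of the two numbers and their sum is at least the
larger. Square roots of this inequality feed the Cauchy-Schwarz step of Le Cam's bound. -/
theorem mul_le_convexComb_mul_add (a a' p p' : ℝ≥0∞) (h : a + a' = 1) :
    p * p' ≤ (a * p + a' * p') * (p + p') := by
  have key : ∀ a a' p p' : ℝ≥0∞, a + a' = 1 → p ≤ p' →
      p * p' ≤ (a * p + a' * p') * (p + p') := fun a a' p p' h hpp => by
    have h1 : p ≤ a * p + a' * p' := by
      calc p = a * p + a' * p := by rw [← add_mul, h, one_mul]
        _ ≤ _ := by gcongr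
    exact mul_le_mul' h1 le_add_self
  rcases le_total p p' with hp | hp
  · exact key a a' p p' h hp
  · have := key a' a p' p (by rwa [add_comm]) hp
    rwa [mul_comm, add_comm (a * p), add_comm p]

/-- Le Cam's two-point bound through the Hellinger affinity, for `n`-fold product measures. -/
theorem hellinger_affinity_le {Ω : Type*} [MeasurableSpace Ω] (μ : Measure Ω) [SigmaFinite μ]
    (n : ℕ) (p p' : Ω → ℝ≥0∞) (hp : Measurable p) (hp' : Measurable p')
    [IsProbabilityMeasure (μ.withDensity p)] [IsProbabilityMeasure (μ.withDensity p')]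
    (a a' : (Fin n → Ω) → ℝ≥0∞) (ha : Measurable a) (ha' : Measurable a')
    (haa : ∀ z, a z + a' z = 1) :
    (∫⁻ x, (p x * p' x) ^ (1 / 2 : ℝ) ∂μ) ^ (2 * n) ≤
      2 * (∫⁻ z, a z ∂(Measure.pi fun _ : Fin n => μ.withDensity p) +
        ∫⁻ z, a' z ∂(Measure.pi fun _ : Fin n => μ.withDensity p')) := by
  set ν := Measure.pi fun _ : Fin n => μ
  set π := fun z : Fin n → Ω => ∏ i, p (z i) with hπ
  set π' := fun z : Fin n → Ω => ∏ i, p' (z i) with hπ'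
  have mπ : Measurable π := Finset.measurable_prod _ fun i _ => hp.comp (measurable_pi_apply i)
  have mπ' : Measurable π' := Finset.measurable_prod _ fun i _ => hp'.comp (measurable_pi_apply i)
  have e1 : Measure.pi (fun _ : Fin n => μ.withDensity p) = ν.withDensity π :=
    pi_withDensity μ n p hp
  have e2 : Measure.pi (fun _ : Fin n => μ.withDensity p') = ν.withDensity π' :=
    pi_withDensity μ n p' hp'
  have one : ∫⁻ z, π z ∂ν = 1 := by
    have : (Measure.pi fun _ : Fin n => μ.withDensity p) Set.univ = 1 := measure_univ
    rwa [e1, withDensity_apply _ .univ, setLIntegral_univ] at this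
  have one' : ∫⁻ z, π' z ∂ν = 1 := by
    have : (Measure.pi fun _ : Fin n => μ.withDensity p') Set.univ = 1 := measure_univ
    rwa [e2, withDensity_apply _ .univ, setLIntegral_univ] at this
  set U := fun z => a z * π z + a' z * π' z
  have mU : Measurable U := (ha.mul mπ).add (ha'.mul mπ')
  have eU : ∫⁻ z, a z ∂(Measure.pi fun _ : Fin n => μ.withDensity p) +
      ∫⁻ z, a' z ∂(Measure.pi fun _ : Fin n => μ.withDensity p') = ∫⁻ z, U z ∂ν := by
    rw [e1, e2, lintegral_withDensity_eq_lintegral_mul _ mπ ha,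
      lintegral_withDensity_eq_lintegral_mul _ mπ' ha', ← lintegral_add_left (mπ.mul ha)]
    refine lintegral_congr fun z => ?_
    simp [U, mul_comm]
  have eρ : (∫⁻ x, (p x * p' x) ^ (1 / 2 : ℝ) ∂μ) ^ n =
      ∫⁻ z, (π z * π' z) ^ (1 / 2 : ℝ) ∂ν := by
    have := lintegral_pi_prod μ n (fun _ x => (p x * p' x) ^ (1 / 2 : ℝ))
      (fun _ => (hp.mul hp').pow_const _)
    rw [Finset.prod_const, Finset.card_univ, Fintype.card_fin] at this
    rw [← this]
    refine lintegral_congr fun z => ?_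
    simp only [hπ, hπ']
    rw [← Finset.prod_mul_distrib, ENNReal.prod_rpow_of_nonneg (by norm_num)]
  -- Cauchy-Schwarz for `√U` and `√(π + π')`; the second factor integrates to the total mass `2` of
  -- the two laws, whence the factor `2` in the bound.
  have hold := ENNReal.lintegral_mul_le_Lp_mul_Lq ν (p := 2) (q := 2)
    (Real.HolderConjugate.two_two) (f := fun z => U z ^ (1 / 2 : ℝ))
    (g := fun z => (π z + π' z) ^ (1 / 2 : ℝ)) (mU.pow_const _).aemeasurable
    ((mπ.add mπ').pow_const _).aemeasurable
  have hsq : ∀ t : ℝ≥0∞, (t ^ (1 / 2 : ℝ)) ^ (2 : ℝ) = t := fun t => by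
    rw [← ENNReal.rpow_mul]; norm_num
  simp only [hsq] at hold
  rw [lintegral_add_left mπ, one, one'] at hold
  have hle : ∫⁻ z, (π z * π' z) ^ (1 / 2 : ℝ) ∂ν ≤
      (∫⁻ z, U z ∂ν) ^ (1 / 2 : ℝ) * (1 + 1 : ℝ≥0∞) ^ (1 / 2 : ℝ) := by
    refine le_trans (lintegral_mono fun z => ?_) hold
    simp only [Pi.mul_apply]
    rw [← ENNReal.mul_rpow_of_nonneg _ _ (by norm_num)]
    exact ENNReal.rpow_le_rpow (mul_le_convexComb_mul_add _ _ _ _ (haa z)) (by norm_num)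
  rw [eU, mul_comm 2 n, pow_mul, eρ]
  calc (∫⁻ z, (π z * π' z) ^ (1 / 2 : ℝ) ∂ν) ^ 2
      ≤ ((∫⁻ z, U z ∂ν) ^ (1 / 2 : ℝ) * (1 + 1 : ℝ≥0∞) ^ (1 / 2 : ℝ)) ^ 2 := by gcongr
    _ = 2 * ∫⁻ z, U z ∂ν := by
      rw [← ENNReal.rpow_natCast, ENNReal.mul_rpow_of_nonneg _ _ (by norm_num)]
      push_cast
      rw [hsq, hsq, mul_comm]; norm_num

/-! ### The joint law -/

/-- The common dominating measure `Q ⊗ (δ₁ + δ₋₁)`. -/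
noncomputable def baseLaw {d : ℕ} (Q : Measure (Cube d)) : Measure (Cube d × Label) :=
  Q.map (fun x => (x, lpos)) + Q.map (fun x => (x, lneg))

/-- The density of `jointLaw η Q` with respect to `baseLaw Q`. -/
noncomputable def labelDensity {d : ℕ} (η : Cube d → ℝ) (z : Cube d × Label) : ℝ≥0∞ :=
  if z.2 = lpos then ENNReal.ofReal (η z.1) else ENNReal.ofReal (1 - η z.1)

theorem lneg_ne_lpos : lneg ≠ lpos := by
  intro h; have := congrArg Subtype.val h; simp [lneg, lpos] at this

theorem eq_lpos_or_eq_lneg (y : Label) : y = lpos ∨ y = lneg := by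
  obtain ⟨y, hy⟩ := y
  rcases hy with h | h
  · right; exact Subtype.ext h
  · left; exact Subtype.ext h

variable {d : ℕ}

theorem lintegral_baseLaw (Q : Measure (Cube d)) (F : Cube d × Label → ℝ≥0∞) (hF : Measurable F) :
    ∫⁻ z, F z ∂(baseLaw Q) = ∫⁻ x, F (x, lpos) + F (x, lneg) ∂Q := by
  rw [baseLaw, lintegral_add_measure, lintegral_map hF measurable_prodMk_right,
    lintegral_map hF measurable_prodMk_right, lintegral_add_left]
  exact hF.comp measurable_prodMk_right

theorem measurable_labelDensity {η : Cube d → ℝ} (hη : Measurable η) :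
    Measurable (labelDensity η) := by
  unfold labelDensity
  refine Measurable.ite (measurable_snd (measurableSet_singleton lpos)) ?_ ?_
  · exact (hη.comp measurable_fst).ennreal_ofReal
  · exact (measurable_const.sub (hη.comp measurable_fst)).ennreal_ofReal

theorem lintegral_jointLaw (Q : Measure (Cube d)) {η : Cube d → ℝ} (hη : Measurable η)
    (F : Cube d × Label → ℝ≥0∞) (hF : Measurable F) :
    ∫⁻ z, F z ∂(jointLaw η Q) = ∫⁻ x, ENNReal.ofReal (η x) * F (x, lpos) +
      ENNReal.ofReal (1 - η x) * F (x, lneg) ∂Q := by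
  have h1 : Measurable fun x => F (x, lpos) := hF.comp measurable_prodMk_right
  have h2 : Measurable fun x => F (x, lneg) := hF.comp measurable_prodMk_right
  have hη' : Measurable fun x => ENNReal.ofReal (1 - η x) :=
    (measurable_const.sub hη).ennreal_ofReal
  rw [jointLaw, lintegral_add_measure, lintegral_map hF measurable_prodMk_right,
    lintegral_map hF measurable_prodMk_right,
    lintegral_withDensity_eq_lintegral_mul _ hη.ennreal_ofReal h1,
    lintegral_withDensity_eq_lintegral_mul _ hη' h2,
    ← lintegral_add_left (hη.ennreal_ofReal.mul h1)]
  rfl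

theorem jointLaw_eq_withDensity (Q : Measure (Cube d)) {η : Cube d → ℝ} (hη : Measurable η) :
    jointLaw η Q = (baseLaw Q).withDensity (labelDensity η) := by
  ext s hs
  have hi : Measurable (s.indicator (1 : Cube d × Label → ℝ≥0∞)) := measurable_one.indicator hs
  rw [withDensity_apply _ hs, ← lintegral_indicator_one hs, lintegral_jointLaw Q hη _ hi,
    ← lintegral_indicator hs, lintegral_baseLaw _ _ ((measurable_labelDensity hη).indicator hs)]
  refine lintegral_congr fun x => ?_
  by_cases h1 : (x, lpos) ∈ s <;> by_cases h2 : (x, lneg) ∈ s <;>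
    simp [Set.indicator, h1, h2, labelDensity, lneg_ne_lpos]

theorem jointLaw_apply (Q : Measure (Cube d)) {η : Cube d → ℝ} (hη : Measurable η)
    {s : Set (Cube d × Label)} (hs : MeasurableSet s) :
    jointLaw η Q s = ∫⁻ x, ENNReal.ofReal (η x) * s.indicator 1 (x, lpos) +
      ENNReal.ofReal (1 - η x) * s.indicator 1 (x, lneg) ∂Q := by
  rw [← lintegral_indicator_one hs,
    lintegral_jointLaw Q hη _ (measurable_one.indicator hs)]

theorem isProbabilityMeasure_jointLaw (Q : Measure (Cube d)) [IsProbabilityMeasure Q]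
    {η : Cube d → ℝ} (hη : Measurable η) (h01 : ∀ x, η x ∈ Set.Icc (0 : ℝ) 1) :
    IsProbabilityMeasure (jointLaw η Q) := by
  refine ⟨?_⟩
  rw [jointLaw_apply Q hη .univ]
  simp only [Set.indicator_univ, Pi.one_apply, mul_one]
  have : ∀ x, ENNReal.ofReal (η x) + ENNReal.ofReal (1 - η x) = 1 := fun x => by
    rw [← ENNReal.ofReal_add (h01 x).1 (by linarith [(h01 x).2])]; simp
  simp [this]

theorem fst_jointLaw (Q : Measure (Cube d)) {η : Cube d → ℝ} (hη : Measurable η)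
    (h01 : ∀ x, η x ∈ Set.Icc (0 : ℝ) 1) : (jointLaw η Q).fst = Q := by
  ext s hs
  rw [Measure.fst_apply hs, jointLaw_apply Q hη (measurable_fst hs), ← lintegral_indicator_one hs]
  refine lintegral_congr fun x => ?_
  have : ENNReal.ofReal (η x) + ENNReal.ofReal (1 - η x) = 1 := by
    rw [← ENNReal.ofReal_add (h01 x).1 (by linarith [(h01 x).2])]; simp
  by_cases hx : x ∈ s <;> simp [Set.indicator, hx, this]

/-- The noise condition is phrased through the disintegration of the law. Its kernel at label `1`
and `η` have the same integral over every measurable set of inputs, hence agree almost everywhere.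
-/
theorem condProb_ae_eq (P : ProbabilityMeasure (Cube d × Label)) (Q : Measure (Cube d))
    [IsProbabilityMeasure Q] {η : Cube d → ℝ} (hη : Measurable η)
    (h01 : ∀ x, η x ∈ Set.Icc (0 : ℝ) 1) (hP : (P : Measure (Cube d × Label)) = jointLaw η Q) :
    ∀ᵐ x ∂Q, condProb P x = η x := by
  have hfst : (P : Measure (Cube d × Label)).fst = Q := by rw [hP, fst_jointLaw Q hη h01]
  have key : (fun x => (P : Measure (Cube d × Label)).condKernel x {lpos}) =ᵐ[Q]
      fun x => ENNReal.ofReal (η x) := by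
    refine ae_eq_of_forall_setLIntegral_eq_of_sigmaFinite
      (ProbabilityTheory.Kernel.measurable_coe _ (measurableSet_singleton _))
      hη.ennreal_ofReal fun s hs _ => ?_
    have h := Measure.setLIntegral_condKernel_eq_measure_prod
      (ρ := (P : Measure (Cube d × Label))) hs (measurableSet_singleton lpos)
    rw [hfst] at h
    rw [h, hP, jointLaw_apply Q hη (hs.prod (measurableSet_singleton _)),
      ← lintegral_indicator hs]
    refine lintegral_congr fun x => ?_
    by_cases hx : x ∈ s <;> simp [Set.indicator, hx, lneg_ne_lpos]
  filter_upwards [key] with x hx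
  rw [condProb, Measure.real, hx, ENNReal.toReal_ofReal (h01 x).1]

end BinClass

/-! ### Excess risk and Assouad's lemma -/

namespace BinClass

variable {d : ℕ}

theorem measurable_sgn : Measurable sgn :=
  Measurable.ite measurableSet_Ici measurable_const measurable_const

theorem measurableSet_misclassified {f : Cube d → ℝ} (hf : Measurable f) :
    MeasurableSet {z : Cube d × Label | sgn (f z.1) ≠ z.2} :=
  (measurableSet_eq_fun (measurable_sgn.comp (hf.comp measurable_fst)) measurable_snd).compl

/-- The conditional risk of `f` given the input. -/
noncomputable def condRisk (η f : Cube d → ℝ) (x : Cube d) : ℝ :=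
  if sgn (f x) = lpos then 1 - η x else η x

theorem jointLaw_misclassified (Q : Measure (Cube d)) {η f : Cube d → ℝ} (hη : Measurable η)
    (hf : Measurable f) :
    jointLaw η Q {z | sgn (f z.1) ≠ z.2} = ∫⁻ x, ENNReal.ofReal (condRisk η f x) ∂Q := by
  rw [jointLaw_apply Q hη (measurableSet_misclassified hf)]
  refine lintegral_congr fun x => ?_
  rcases eq_lpos_or_eq_lneg (sgn (f x)) with h | h <;>
    simp [Set.indicator, h, lneg_ne_lpos, lneg_ne_lpos.symm, condRisk]

theorem measurable_condRisk {η f : Cube d → ℝ} (hη : Measurable η) (hf : Measurable f) :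
    Measurable (condRisk η f) :=
  Measurable.ite ((measurable_sgn.comp hf) (measurableSet_singleton lpos))
    (measurable_const.sub hη) hη

/-- The two conditional risks available at a point are `η` and `1 - η`, which differ by `|2η - 1|`;
the sign of `2η - 1` picks the smaller one. -/
theorem condRisk_eq_bayes_add (η f : Cube d → ℝ) (x : Cube d) :
    condRisk η f x = condRisk η (fun x => 2 * η x - 1) x +
      |2 * η x - 1| * (if sgn (f x) = sgn (2 * η x - 1) then 0 else 1) := by
  unfold condRisk
  by_cases h : 0 ≤ 2 * η x - 1
  · have h1 : sgn (2 * η x - 1) = lpos := by simp only [sgn, if_pos h]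
    rcases eq_lpos_or_eq_lneg (sgn (f x)) with h2 | h2
    · simp [h1, h2]
    · simp only [h1, h2, lneg_ne_lpos, if_false, if_true, abs_of_nonneg h]; ring
  · have h1 : sgn (2 * η x - 1) = lneg := by simp only [sgn, if_neg h]
    rcases eq_lpos_or_eq_lneg (sgn (f x)) with h2 | h2
    · simp only [h1, h2, lneg_ne_lpos.symm, lneg_ne_lpos, if_false, if_true,
        abs_of_neg (not_le.1 h)]; ring
    · simp [h1, h2]

theorem condRisk_nonneg {η : Cube d → ℝ} (h01 : ∀ x, η x ∈ Set.Icc (0 : ℝ) 1) (f : Cube d → ℝ)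
    (x : Cube d) : 0 ≤ condRisk η f x := by
  unfold condRisk; split_ifs <;> linarith [(h01 x).1, (h01 x).2]

/-- Integrate `condRisk_eq_bayes_add` and bound the infimum of the risks by the risk of the Bayes
rule `2η - 1`. Only this inequality is needed, not the optimality of that rule. -/
theorem lintegral_le_excessRisk (P : ProbabilityMeasure (Cube d × Label)) (Q : Measure (Cube d))
    {η f : Cube d → ℝ} (hη : Measurable η)
    (h01 : ∀ x, η x ∈ Set.Icc (0 : ℝ) 1) (hP : (P : Measure (Cube d × Label)) = jointLaw η Q)
    (hf : Measurable f) :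
    ∫⁻ x, ENNReal.ofReal (|2 * η x - 1| *
        (if sgn (f x) = sgn (2 * η x - 1) then 0 else 1)) ∂Q ≤
      ENNReal.ofReal (excessRisk P f) := by
  set R := ∫⁻ x, ENNReal.ofReal (|2 * η x - 1| *
        (if sgn (f x) = sgn (2 * η x - 1) then 0 else 1)) ∂Q with hR
  have hg : Measurable fun x => 2 * η x - 1 := (hη.const_mul 2).sub_const 1
  have hadd : (P : Measure (Cube d × Label)) {z | sgn (f z.1) ≠ z.2} =
      (P : Measure (Cube d × Label)) {z | sgn (2 * η z.1 - 1) ≠ z.2} + R := by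
    rw [hP, jointLaw_misclassified Q hη hf, jointLaw_misclassified Q hη hg, hR,
      ← lintegral_add_left (measurable_condRisk hη hg).ennreal_ofReal]
    refine lintegral_congr fun x => ?_
    rw [condRisk_eq_bayes_add, ENNReal.ofReal_add (condRisk_nonneg h01 _ x)]
    positivity
  have hRtop : R ≠ ⊤ := ne_top_of_le_ne_top (measure_ne_top (P : Measure (Cube d × Label))
    {z | sgn (f z.1) ≠ z.2}) (hadd ▸ le_add_self)
  have hrisk : risk P f = risk P (fun x => 2 * η x - 1) + R.toReal := by
    rw [risk, Measure.real, hadd, ENNReal.toReal_add (measure_ne_top _ _) hRtop]; rfl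
  have hinf : (⨅ g : {g : Cube d → ℝ // Measurable g}, risk P g.1) ≤
      risk P (fun x => 2 * η x - 1) :=
    ciInf_le ⟨0, by rintro _ ⟨g, rfl⟩; exact ENNReal.toReal_nonneg⟩
      (⟨_, hg⟩ : {g : Cube d → ℝ // Measurable g})
  rw [← ENNReal.ofReal_toReal hRtop]
  refine ENNReal.ofReal_le_ofReal ?_
  rw [excessRisk, hrisk]; linarith

/-- The label predicted with certainty from a bit. -/
def bitLabel (b : Bool) : Label := if b then lpos else lneg

/-- The sign of a bit. -/
def bitSign (b : Bool) : ℝ := if b then 1 else -1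

theorem sgn_bitSign_mul {ε : ℝ} (hε : 0 < ε) (b : Bool) : sgn (bitSign b * ε) = bitLabel b := by
  cases b
  · simp [sgn, bitSign, bitLabel, hε]
  · simp [sgn, bitSign, bitLabel, hε.le]

/-- An estimator only promises measurability of its excess risks. For the law with `η = 1` and
marginal `Q` the risk is exactly this mass, and it differs from the excess risk by a constant. -/
theorem measurable_measure_sgn_ne_lpos {n : ℕ} (f : Estimator d n) (Q : Measure (Cube d))
    [IsProbabilityMeasure Q] : Measurable fun z => Q {x | sgn (f.toFun z x) ≠ lpos} := by
  have h1 : Measurable fun _ : Cube d => (1 : ℝ) := measurable_const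
  let P : ProbabilityMeasure (Cube d × Label) :=
    ⟨jointLaw (fun _ => 1) Q, isProbabilityMeasure_jointLaw Q h1 (by simp)⟩
  have hm := f.measurable_excessRisk P
  have : (fun z => Q {x | sgn (f.toFun z x) ≠ lpos}) = fun z => ENNReal.ofReal
      (excessRisk P (f.toFun z) + ⨅ g : {g : Cube d → ℝ // Measurable g}, risk P g.1) := by
    funext z
    have hs : MeasurableSet {x | sgn (f.toFun z x) ≠ lpos} :=
      ((measurable_sgn.comp (f.measurable_toFun z)) (measurableSet_singleton lpos)).compl
    rw [excessRisk, sub_add_cancel, risk, ofReal_measureReal]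
    change _ = jointLaw (fun _ => 1) Q _
    rw [jointLaw_misclassified Q h1 (f.measurable_toFun z), ← lintegral_indicator_one hs]
    refine lintegral_congr fun x => ?_
    by_cases h : sgn (f.toFun z x) = lpos <;> simp [condRisk, h, Set.indicator]
  rw [this]
  exact (hm.add_const _).ennreal_ofReal

/-- A lower bound for the Hellinger affinity of two joint laws which differ only on a set `A`. -/
theorem le_affinity (Q : Measure (Cube d)) [IsProbabilityMeasure Q] {η η' : Cube d → ℝ}
    (hη : Measurable η) (hη' : Measurable η')
    (h01 : ∀ x, η x ∈ Set.Icc (0 : ℝ) 1) {A : Set (Cube d)} (hA : MeasurableSet A) {ε w : ℝ}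
    (hε0 : 0 ≤ ε) (hε1 : ε ≤ 1) (hw : 0 ≤ w) (hw1 : w ≤ 1) (hQA : Q A = ENNReal.ofReal w)
    (hprod : ∀ x ∈ A, η x * η' x = (1 - ε ^ 2) / 4 ∧ (1 - η x) * (1 - η' x) = (1 - ε ^ 2) / 4)
    (heq : ∀ᵐ x ∂Q, x ∉ A → η x = η' x) :
    ENNReal.ofReal (1 - w * ε ^ 2) ≤
      ∫⁻ z, (labelDensity η z * labelDensity η' z) ^ (1 / 2 : ℝ) ∂(baseLaw Q) := by
  have hε2 : ε ^ 2 ≤ 1 := by nlinarith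
  have hmeas : Measurable fun z => (labelDensity η z * labelDensity η' z) ^ (1 / 2 : ℝ) :=
    ((measurable_labelDensity hη).mul (measurable_labelDensity hη')).pow_const _
  rw [lintegral_baseLaw _ _ hmeas]
  have hQc : Q Aᶜ = ENNReal.ofReal (1 - w) := by
    rw [prob_compl_eq_one_sub hA, hQA, ENNReal.ofReal_sub _ hw, ENNReal.ofReal_one]
  calc ENNReal.ofReal (1 - w * ε ^ 2)
      = ENNReal.ofReal (1 - ε ^ 2) * Q A + 1 * Q Aᶜ := by
        rw [hQA, hQc, one_mul, ← ENNReal.ofReal_mul (by linarith),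
          ← ENNReal.ofReal_add (mul_nonneg (by linarith) hw) (by linarith)]
        congr 1; ring
    _ = ∫⁻ x, A.indicator (fun _ => ENNReal.ofReal (1 - ε ^ 2)) x +
          Aᶜ.indicator (fun _ => 1) x ∂Q := by
        rw [lintegral_add_left (measurable_const.indicator hA), lintegral_indicator_const hA,
          lintegral_indicator_const hA.compl]
    _ ≤ _ := by
        refine lintegral_mono_ae ?_
        filter_upwards [heq] with x hx
        simp only [labelDensity, if_true, lneg_ne_lpos, if_false]
        by_cases hxA : x ∈ A
        · obtain ⟨h1, h2⟩ := hprod x hxA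
          -- For each label the integrand on `A` is `√(1 - ε²)/2`, which is at least `(1 - ε²)/2`
          -- since `1 - ε² ≤ 1`.
          have hroot : ENNReal.ofReal ((1 - ε ^ 2) / 2) ≤
              ENNReal.ofReal ((1 - ε ^ 2) / 4) ^ (1 / 2 : ℝ) := by
            rw [ENNReal.ofReal_rpow_of_nonneg (by linarith) (by norm_num),
              ← Real.sqrt_eq_rpow]
            refine ENNReal.ofReal_le_ofReal (Real.le_sqrt_of_sq_le ?_)
            nlinarith [sq_nonneg ε]
          rw [← ENNReal.ofReal_mul (h01 x).1, ← ENNReal.ofReal_mul (by linarith [(h01 x).2]),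
            h1, h2]
          simp only [Set.indicator_of_mem hxA, Set.indicator_of_notMem (Set.notMem_compl_iff.2 hxA),
            add_zero]
          calc ENNReal.ofReal (1 - ε ^ 2)
              = ENNReal.ofReal ((1 - ε ^ 2) / 2) + ENNReal.ofReal ((1 - ε ^ 2) / 2) := by
                rw [← ENNReal.ofReal_add (by linarith) (by linarith)]; congr 1; ring
            _ ≤ _ := add_le_add hroot hroot
        · rw [← hx hxA]
          have hsq : ∀ t : ℝ≥0∞, (t * t) ^ (1 / 2 : ℝ) = t := fun t => by
            rw [← sq, ← ENNReal.rpow_natCast, ← ENNReal.rpow_mul]; norm_num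
          rw [hsq, hsq, ← ENNReal.ofReal_add (h01 x).1 (by linarith [(h01 x).2])]
          simp [hxA]

/-- Bernoulli's inequality gives `(1 - 1/(2n))^n ≥ 1/2`; square it. -/
theorem one_fourth_le_one_sub_pow {n : ℕ} (hn : 1 ≤ n) {x : ℝ} (hx : x ≤ 1 / (2 * n)) :
    1 / 4 ≤ (1 - x) ^ (2 * n) := by
  have hn' : (1 : ℝ) ≤ n := by exact_mod_cast hn
  have h2 : 1 / (2 * (n : ℝ)) ≤ 1 / 2 := by
    rw [div_le_div_iff₀ (by positivity) (by norm_num)]; linarith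
  have h := one_add_mul_le_pow (a := -(1 / (2 * (n : ℝ)))) (by linarith) n
  have e : 1 + (n : ℝ) * -(1 / (2 * n)) = 1 / 2 := by field_simp; norm_num
  rw [e] at h
  have h3 : (1 : ℝ) / 2 ≤ (1 - x) ^ n :=
    h.trans (pow_le_pow_left₀ (by linarith) (by linarith) n)
  rw [mul_comm, pow_mul]
  nlinarith

theorem flip_flip {ι : Type*} [DecidableEq ι] (i : ι) :
    Function.Involutive fun σ : ι → Bool => Function.update σ i (!σ i) := by
  intro σ; simp

/-- Assouad's lemma for the excess classification risk. -/
theorem le_minimaxRisk {ι : Type*} [Fintype ι] [DecidableEq ι] {n : ℕ} (hn : 1 ≤ n)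
    (Q : Measure (Cube d)) [IsProbabilityMeasure Q] (A : ι → Set (Cube d))
    (hA : ∀ i, MeasurableSet (A i)) (hdisj : Pairwise (Function.onFun Disjoint A))
    (η : (ι → Bool) → Cube d → ℝ) (hη : ∀ σ, Measurable (η σ))
    (h01 : ∀ σ x, η σ x ∈ Set.Icc (0 : ℝ) 1) {ε w : ℝ} (hε0 : 0 < ε) (hε1 : ε ≤ 1) (hw : 0 < w)
    (hQA : ∀ i, Q (A i) = ENNReal.ofReal w)
    (hηA : ∀ σ i, ∀ x ∈ A i, η σ x = 1 / 2 + bitSign (σ i) * ε / 2)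
    (hηE : ∀ᵐ x ∂Q, (∃ i, x ∈ A i) ∨ ∀ σ, η σ x = 1)
    (hwn : w * ε ^ 2 ≤ 1 / (2 * n)) (S : Set (ProbabilityMeasure (Cube d × Label)))
    (P : (ι → Bool) → ProbabilityMeasure (Cube d × Label))
    (hP : ∀ σ, (P σ : Measure (Cube d × Label)) = jointLaw (η σ) Q) (hPS : ∀ σ, P σ ∈ S) :
    ENNReal.ofReal (Fintype.card ι * w * ε / 16) ≤ minimaxRisk d n S := by
  refine le_iInf fun f => ?_
  set M := ⨆ P ∈ S, expectedExcessRisk P f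
  have hM : ∀ σ, expectedExcessRisk (P σ) f ≤ M := fun σ => le_iSup₂_of_le (P σ) (hPS σ) le_rfl
  have hQ0 : ∀ i, Q (A i) ≠ 0 := fun i => by rw [hQA i]; simpa using hw
  have hQprob : ∀ i, IsProbabilityMeasure (ProbabilityTheory.cond Q (A i)) := fun i =>
    ProbabilityTheory.cond_isProbabilityMeasure (hQ0 i)
  -- The relative mass, within cell `i`, of the points where the estimate disagrees with bit value
  -- `b`; conditioning on the cell makes the errors for the two values sum to `1`, as a pair of
  -- randomised tests must.
  set err : ι → Bool → (Fin n → Cube d × Label) → ℝ≥0∞ := fun i b z =>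
    ProbabilityTheory.cond Q (A i) {x | sgn (f.toFun z x) ≠ bitLabel b} with herr
  have hset : ∀ z b, MeasurableSet {x | sgn (f.toFun z x) ≠ bitLabel b} := fun z b =>
    ((measurable_sgn.comp (f.measurable_toFun z)) (measurableSet_singleton (bitLabel b))).compl
  have herrc : ∀ i z, err i false z = 1 - err i true z := fun i z => by
    rw [herr]
    simp only
    rw [← prob_compl_eq_one_sub (hset z true)]
    congr 1; ext x
    rcases eq_lpos_or_eq_lneg (sgn (f.toFun z x)) with h | h <;>
      simp [h, bitLabel, lneg_ne_lpos, lneg_ne_lpos.symm]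
  have herr1 : ∀ i b z, err i b z + err i (!b) z = 1 := fun i b z => by
    have h1 : err i true z ≤ 1 := prob_le_one
    cases b
    · rw [Bool.not_false, herrc]; exact tsub_add_cancel_of_le h1
    · rw [Bool.not_true, herrc]; exact add_tsub_cancel_of_le h1
  have mtrue : ∀ i, Measurable (err i true) := fun i =>
    measurable_measure_sgn_ne_lpos f (ProbabilityTheory.cond Q (A i))
  have merr : ∀ i b, Measurable (err i b) := fun i b => by
    cases b
    · rw [show err i false = fun z => 1 - err i true z from funext (herrc i)]
      exact measurable_const.sub (mtrue i)
    · exact mtrue i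
  set J : (ι → Bool) → ι → ℝ≥0∞ := fun σ i =>
    ∫⁻ z, err i (σ i) z ∂(Measure.pi fun _ : Fin n => (P σ : Measure (Cube d × Label)))
  -- Drop the part of the excess risk outside the cells; on cell `i` the margin is `ε`, so the loss
  -- there is `w ε` times the relative error.
  have hJ : ∀ σ, ∑ i, ENNReal.ofReal (w * ε) * J σ i ≤ M := fun σ => by
    refine le_trans ?_ (hM σ)
    simp only [J]
    simp_rw [← lintegral_const_mul _ (merr _ _)]
    rw [← lintegral_finsetSum _ fun i _ => (merr _ _).const_mul _]
    refine lintegral_mono fun z => ?_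
    refine le_trans ?_ (lintegral_le_excessRisk (P σ) Q (hη σ) (h01 σ) (hP σ)
      (f.measurable_toFun z))
    calc ∑ i, ENNReal.ofReal (w * ε) * err i (σ i) z
        = ∑ i, ∫⁻ x in A i, ENNReal.ofReal (|2 * η σ x - 1| *
          (if sgn (f.toFun z x) = sgn (2 * η σ x - 1) then 0 else 1)) ∂Q := by
          refine Finset.sum_congr rfl fun i _ => ?_
          have hc : ∫⁻ x in A i, ENNReal.ofReal (|2 * η σ x - 1| *
              (if sgn (f.toFun z x) = sgn (2 * η σ x - 1) then 0 else 1)) ∂Q =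
              ∫⁻ x in A i, {x | sgn (f.toFun z x) ≠ bitLabel (σ i)}.indicator
                (fun _ => ENNReal.ofReal ε) x ∂Q := by
            refine setLIntegral_congr_fun (hA i) fun x hx => ?_
            have e : 2 * η σ x - 1 = bitSign (σ i) * ε := by rw [hηA σ i x hx]; ring
            simp only [e, sgn_bitSign_mul hε0]
            have habs : |bitSign (σ i) * ε| = ε := by
              cases σ i <;> simp [bitSign, hε0.le]
            by_cases h : sgn (f.toFun z x) = bitLabel (σ i) <;> simp [h, habs]
          rw [hc, lintegral_indicator_const (hset z _), Measure.restrict_apply (hset z _)]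
          simp only [herr]
          rw [ProbabilityTheory.cond_apply (hA i), hQA i, ENNReal.ofReal_mul hw.le,
            Set.inter_comm]
          have : ENNReal.ofReal w * (ENNReal.ofReal w)⁻¹ = 1 :=
            ENNReal.mul_inv_cancel (by simpa using hw) ENNReal.ofReal_ne_top
          calc _ = (ENNReal.ofReal w * (ENNReal.ofReal w)⁻¹) * (ENNReal.ofReal ε *
              Q ({x | sgn (f.toFun z x) ≠ bitLabel (σ i)} ∩ A i)) := by ring
            _ = _ := by rw [this, one_mul]
      _ = ∫⁻ x in ⋃ i, A i, ENNReal.ofReal (|2 * η σ x - 1| *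
          (if sgn (f.toFun z x) = sgn (2 * η σ x - 1) then 0 else 1)) ∂Q := by
          rw [lintegral_iUnion hA hdisj, tsum_fintype]
      _ ≤ _ := setLIntegral_le_lintegral _ _
  -- The laws of `σ` and of `σ` with bit `i` flipped differ only on `A i`. Their `2n`-th affinity
  -- power is at least `1/4`, and Le Cam's bound divides this by `2`.
  have hpair : ∀ i σ, 1 / 8 ≤ J σ i + J (Function.update σ i (!σ i)) i := fun i σ => by
    set σ' := Function.update σ i (!σ i) with hσ'
    have hw1 : w ≤ 1 := by
      have : Q (A i) ≤ 1 := prob_le_one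
      rw [hQA i] at this; simpa using this
    have haff := le_affinity Q (hη σ) (hη σ') (h01 σ) (hA i) hε0.le hε1 hw.le hw1 (hQA i)
      (fun x hx => by
        rw [hηA σ i x hx, hηA σ' i x hx, hσ', Function.update_self]
        cases σ i <;> simp [bitSign] <;> constructor <;> ring)
      (by
        filter_upwards [hηE] with x hx hxA
        rcases hx with ⟨k, hk⟩ | hx
        · rw [hηA σ k x hk, hηA σ' k x hk, hσ', Function.update_of_ne]
          rintro rfl; exact hxA hk
        · rw [hx, hx])
    have e1 := jointLaw_eq_withDensity Q (hη σ)
    have e2 := jointLaw_eq_withDensity Q (hη σ')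
    have : IsProbabilityMeasure ((baseLaw Q).withDensity (labelDensity (η σ))) := by
      rw [← e1, ← hP]; infer_instance
    have : IsProbabilityMeasure ((baseLaw Q).withDensity (labelDensity (η σ'))) := by
      rw [← e2, ← hP]; infer_instance
    have : IsFiniteMeasure (baseLaw Q) := by unfold baseLaw; infer_instance
    have hlc := hellinger_affinity_le (baseLaw Q) n _ _ (measurable_labelDensity (hη σ))
      (measurable_labelDensity (hη σ')) (err i (σ i)) (err i (!σ i)) (merr _ _) (merr _ _)
      (herr1 i (σ i))
    have hJ1 : J σ i + J σ' i = ∫⁻ z, err i (σ i) z ∂(Measure.pi fun _ : Fin n =>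
          (baseLaw Q).withDensity (labelDensity (η σ))) +
        ∫⁻ z, err i (!σ i) z ∂(Measure.pi fun _ : Fin n =>
          (baseLaw Q).withDensity (labelDensity (η σ'))) := by
      simp only [J, hP, e1, e2]
      rw [hσ', Function.update_self]
    rw [hJ1]
    have h4 : ENNReal.ofReal (1 / 4) ≤ ENNReal.ofReal (1 - w * ε ^ 2) ^ (2 * n) := by
      have h1 : w * ε ^ 2 ≤ 1 := by nlinarith [sq_nonneg ε]
      rw [← ENNReal.ofReal_pow (by linarith)]
      exact ENNReal.ofReal_le_ofReal (one_fourth_le_one_sub_pow hn hwn)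
    have h5 := h4.trans ((pow_le_pow_left' haff _).trans hlc)
    have h6 : (1 / 8 : ℝ≥0∞) = 2⁻¹ * ENNReal.ofReal (1 / 4) := by
      rw [show (2 : ℝ≥0∞) = ENNReal.ofReal 2 by simp, ← ENNReal.ofReal_inv_of_pos (by norm_num),
        ← ENNReal.ofReal_mul (by norm_num)]
      rw [show (8 : ℝ≥0∞) = ENNReal.ofReal 8 by simp, ← ENNReal.ofReal_one,
        ← ENNReal.ofReal_div_of_pos (by norm_num)]
      norm_num
    rw [h6]
    calc _ ≤ 2⁻¹ * (2 * _) := mul_le_mul_right h5 _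
      _ = _ := by rw [← mul_assoc, ENNReal.inv_mul_cancel (by simp) (by simp), one_mul]
  have hsum : ∀ i, (Fintype.card (ι → Bool) : ℝ≥0∞) * (1 / 8) ≤ 2 * ∑ σ, J σ i := fun i => by
    -- Flipping bit `i` permutes the bit vectors, so both halves of the pair bound have the same
    -- sum.
    have hflip : ∑ σ, J (Function.update σ i (!σ i)) i = ∑ σ, J σ i :=
      Equiv.sum_comp (flip_flip i).toPerm fun σ => J σ i
    calc (Fintype.card (ι → Bool) : ℝ≥0∞) * (1 / 8) = ∑ _σ : ι → Bool, (1 / 8 : ℝ≥0∞) := by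
          rw [Finset.sum_const, Finset.card_univ, nsmul_eq_mul]
      _ ≤ ∑ σ, (J σ i + J (Function.update σ i (!σ i)) i) := Finset.sum_le_sum fun σ _ => hpair i σ
      _ = _ := by rw [Finset.sum_add_distrib, hflip, two_mul]
  set c : ℝ≥0∞ := (Fintype.card (ι → Bool) : ℝ≥0∞)
  have hc0 : c ≠ 0 := by simp [c]
  have hct : c ≠ ⊤ := ENNReal.natCast_ne_top _
  have h1 : c * ((Fintype.card ι : ℝ≥0∞) * (ENNReal.ofReal (w * ε) * (1 / 8))) ≤ c * (2 * M) := by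
    calc c * ((Fintype.card ι : ℝ≥0∞) * (ENNReal.ofReal (w * ε) * (1 / 8)))
        = ∑ _i : ι, ENNReal.ofReal (w * ε) * (c * (1 / 8)) := by
          rw [Finset.sum_const, Finset.card_univ, nsmul_eq_mul]; ring
      _ ≤ ∑ i, ENNReal.ofReal (w * ε) * (2 * ∑ σ, J σ i) :=
          Finset.sum_le_sum fun i _ => mul_le_mul_right (hsum i) _
      _ = 2 * ∑ σ, ∑ i, ENNReal.ofReal (w * ε) * J σ i := by
          rw [Finset.sum_comm, Finset.mul_sum]
          refine Finset.sum_congr rfl fun i _ => ?_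
          rw [← Finset.mul_sum]; ring
      _ ≤ 2 * ∑ _σ : ι → Bool, M := mul_le_mul_right (Finset.sum_le_sum fun σ _ => hJ σ) _
      _ = c * (2 * M) := by rw [Finset.sum_const, Finset.card_univ, nsmul_eq_mul]; ring
  have h2 := (ENNReal.mul_le_mul_iff_right hc0 hct).1 h1
  have h3 : ENNReal.ofReal (Fintype.card ι * w * ε / 16) * 2 =
      (Fintype.card ι : ℝ≥0∞) * (ENNReal.ofReal (w * ε) * (1 / 8)) := by
    rw [show (2 : ℝ≥0∞) = ENNReal.ofReal 2 by simp, show (8 : ℝ≥0∞) = ENNReal.ofReal 8 by simp,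
      ← ENNReal.ofReal_natCast, ← ENNReal.ofReal_one, ← ENNReal.ofReal_div_of_pos (by norm_num),
      ← ENNReal.ofReal_mul (by positivity), ← ENNReal.ofReal_mul (by positivity),
      ← ENNReal.ofReal_mul (by positivity)]
    congr 1; ring
  rw [← h3, mul_comm] at h2
  exact (ENNReal.mul_le_mul_iff_right (by simp) (by simp)).1 h2

end BinClass

/-! ### The noise condition for two-valued margins -/

namespace BinClass

/-- Three ranges of `t`. Below `ε` the event is null. From `ε` up to `1` it is contained in `B` up
to a null set, and `Q B ≤ α ε^s ≤ α t^s`. From `1` on, `t ≤ τ` forces `1 ≤ τ`, so the exclusion of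
`α < 1 ≤ τ` gives `α ≥ 1` and the bound is trivial. -/
theorem mem_noiseClass {d : ℕ} (P : ProbabilityMeasure (Cube d × Label)) (Q : Measure (Cube d))
    [IsProbabilityMeasure Q] {η : Cube d → ℝ} (hη : Measurable η)
    (h01 : ∀ x, η x ∈ Set.Icc (0 : ℝ) 1) (hP : (P : Measure (Cube d × Label)) = jointLaw η Q)
    {B : Set (Cube d)} {ε α : ℝ} {s τ : ℝ≥0∞} (hε : 0 < ε) (hα : 0 < α)
    (hατ : ¬ (α < 1 ∧ 1 ≤ τ)) (hB : ∀ x ∈ B, |2 * η x - 1| = ε)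
    (hBc : ∀ᵐ x ∂Q, x ∈ B ∨ |2 * η x - 1| = 1) (hs : s = ⊤ → ε = 1)
    (hQB : s ≠ ⊤ → Q B ≤ ENNReal.ofReal (α * ε ^ s.toReal)) : P ∈ noiseClass d s α τ := by
  intro t ht htτ
  have hfst : (P : Measure (Cube d × Label)).fst = Q := by rw [hP, fst_jointLaw Q hη h01]
  rw [hfst]
  have hae : ∀ᵐ x ∂Q, |2 * condProb P x - 1| ≤ t → |2 * η x - 1| ≤ t := by
    filter_upwards [condProb_ae_eq P Q hη h01 hP] with x hx h
    rwa [hx] at h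
  by_cases ht1 : 1 ≤ t
  · have hα1 : 1 ≤ α := by
      by_contra h
      refine hατ ⟨not_le.1 h, le_trans ?_ htτ⟩
      rw [← ENNReal.ofReal_one]; exact ENNReal.ofReal_le_ofReal ht1
    calc _ ≤ (1 : ℝ≥0∞) * 1 := by rw [one_mul]; exact prob_le_one
      _ ≤ _ := by
        refine mul_le_mul' (by rw [← ENNReal.ofReal_one]; exact ENNReal.ofReal_le_ofReal hα1) ?_
        unfold powTop
        split_ifs with h1 h2 h3
        · linarith
        · exact le_rfl
        · exact le_top
        · rw [← ENNReal.ofReal_one]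
          exact ENNReal.ofReal_le_ofReal (Real.one_le_rpow ht1 ENNReal.toReal_nonneg)
  · have ht1 := not_le.1 ht1
    by_cases htε : t < ε
    · have : Q {x | |2 * condProb P x - 1| ≤ t} = 0 := by
        refine measure_eq_zero_iff_ae_notMem.2 ?_
        filter_upwards [hae, hBc] with x hx hx2 hmem
        have h := hx hmem
        rcases hx2 with h2 | h2
        · rw [hB x h2] at h; linarith
        · rw [h2] at h; linarith
      rw [this]; exact zero_le
    -- At `s = ∞` the margin is `1`, and then the range `ε ≤ t < 1` is empty.
    · have hst : s ≠ ⊤ := fun h => by rw [hs h] at htε; exact htε ht1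
      calc Q {x | |2 * condProb P x - 1| ≤ t} ≤ Q B := by
            refine measure_mono_ae ?_
            filter_upwards [hae, hBc] with x hx hx2 hmem
            have h := hx hmem
            rcases hx2 with h2 | h2
            · exact h2
            · rw [h2] at h; linarith
        _ ≤ ENNReal.ofReal (α * ε ^ s.toReal) := hQB hst
        _ ≤ ENNReal.ofReal α * powTop t s := by
            rw [powTop, if_neg hst, ← ENNReal.ofReal_mul hα.le]
            refine ENNReal.ofReal_le_ofReal (mul_le_mul_of_nonneg_left ?_ hα.le)
            exact Real.rpow_le_rpow hε.le (not_lt.1 htε) ENNReal.toReal_nonneg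

/-! ### Smooth functions with Hölder bounds -/

open scoped ContDiff

/-- Smooth functions on the whole space with a global Hölder bound. -/
structure SmoothHolder (m : ℕ) (β : ℝ) (G : EuclideanSpace ℝ (Fin m) → ℝ) (B : ℝ) : Prop where
  contDiff : ContDiff ℝ ∞ G
  bound : ∀ k ≤ ⌈β⌉₊ - 1, ∀ x, ‖iteratedFDeriv ℝ k G x‖ ≤ B
  holder : ∀ x z, ‖iteratedFDeriv ℝ (⌈β⌉₊ - 1) G x - iteratedFDeriv ℝ (⌈β⌉₊ - 1) G z‖ ≤
    B * ‖x - z‖ ^ (β + 1 - (⌈β⌉₊ : ℝ))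

variable {m : ℕ} {β : ℝ}

theorem SmoothHolder.nonneg {G : EuclideanSpace ℝ (Fin m) → ℝ} {B : ℝ} (h : SmoothHolder m β G B) :
    0 ≤ B :=
  (norm_nonneg _).trans (h.bound 0 (Nat.zero_le _) 0)

theorem SmoothHolder.add {G G' : EuclideanSpace ℝ (Fin m) → ℝ} {B B' : ℝ}
    (h : SmoothHolder m β G B) (h' : SmoothHolder m β G' B') :
    SmoothHolder m β (fun x => G x + G' x) (B + B') := by
  have e : ∀ k x, iteratedFDeriv ℝ k (fun x => G x + G' x) x =
      iteratedFDeriv ℝ k G x + iteratedFDeriv ℝ k G' x := fun k x =>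
    fun_iteratedFDeriv_add_apply ((h.contDiff.of_le (by exact_mod_cast le_top)).contDiffAt)
      ((h'.contDiff.of_le (by exact_mod_cast le_top)).contDiffAt)
  refine ⟨h.contDiff.add h'.contDiff, fun k hk x => ?_, fun x z => ?_⟩
  · rw [e]; exact (norm_add_le _ _).trans (add_le_add (h.bound k hk x) (h'.bound k hk x))
  · rw [e, e, add_sub_add_comm, add_mul]
    exact (norm_add_le _ _).trans (add_le_add (h.holder x z) (h'.holder x z))

theorem norm_partialDeriv_le {k : ℕ} (i : Fin k → Fin m)
    (T : ContinuousMultilinearMap ℝ (fun _ : Fin k => EuclideanSpace ℝ (Fin m)) ℝ) :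
    |T fun j => EuclideanSpace.single (i j) (1 : ℝ)| ≤ ‖T‖ := by
  have := T.le_opNorm fun j => EuclideanSpace.single (i j) (1 : ℝ)
  simpa using this

theorem isCompact_closedCube (m : ℕ) : IsCompact (closedCube m) := by
  have h : IsCompact (Set.univ.pi fun _ : Fin m => Set.Icc (0 : ℝ) 1) :=
    isCompact_univ_pi fun _ => isCompact_Icc
  have h2 := h.image (PiLp.continuous_toLp 2 fun _ : Fin m => ℝ)
  convert! h2 using 1
  ext x
  constructor
  · intro hx; exact ⟨x.ofLp, fun i _ => hx i, rfl⟩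
  · rintro ⟨y, hy, rfl⟩ i; exact hy i trivial

theorem openCube_subset_closedCube (m : ℕ) : openCube m ⊆ closedCube m :=
  fun _ hx i => Set.Ioo_subset_Icc_self (hx i)

/-- The Hölder norm is the sum of a supremum part and a seminorm part, each at most `B`; hence the
factor `2`. -/
theorem mem_holderBall_of_le {g : Cube m → ℝ} {G : EuclideanSpace ℝ (Fin m) → ℝ} {B r : ℝ}
    (hg : ∀ x : Cube m, g x = G (WithLp.toLp 2 fun i => (x i : ℝ))) (hB : 0 ≤ B)
    (hc : ContDiffOn ℝ ((⌈β⌉₊ - 1 : ℕ) : ℕ∞) G (openCube m)) (hG : ContinuousOn G (closedCube m))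
    (hu : ∀ k : ℕ, k ≤ ⌈β⌉₊ - 1 → ∀ i : Fin k → Fin m,
      UniformContinuousOn (partialDeriv G i) (openCube m))
    (h1 : ∀ k ≤ ⌈β⌉₊ - 1, ∀ i : Fin k → Fin m, ∀ x ∈ openCube m, |partialDeriv G i x| ≤ B)
    (h2 : ∀ i : Fin (⌈β⌉₊ - 1) → Fin m, ∀ x ∈ openCube m, ∀ z ∈ openCube m,
      |partialDeriv G i x - partialDeriv G i z| ≤ B * ‖x - z‖ ^ (β + 1 - (⌈β⌉₊ : ℝ)))
    (hr : 2 * B ≤ r) : g ∈ holderBall m β r := by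
  refine ⟨G, hg, hG, hc, hu, ?_⟩
  have hsum : ENNReal.ofReal r ≥ ENNReal.ofReal B + ENNReal.ofReal B := by
    rw [← ENNReal.ofReal_add hB hB]; exact ENNReal.ofReal_le_ofReal (by linarith)
  refine le_trans (add_le_add ?_ ?_) hsum
  · refine iSup₂_le fun k hk => iSup_le fun i => iSup₂_le fun x hx => ENNReal.ofReal_le_ofReal ?_
    have := Nat.lt_ceil.2 hk
    exact h1 k (by omega) i x hx
  · refine iSup_le fun i => iSup₂_le fun x hx => iSup₂_le fun z hz => iSup_le fun hxz =>
      ENNReal.ofReal_le_ofReal ?_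
    have : 0 < ‖x - z‖ := norm_pos_iff.2 (sub_ne_zero.2 hxz)
    rw [div_le_iff₀ (Real.rpow_pos_of_pos this _)]
    exact h2 i x hx z hz

theorem SmoothHolder.mem_holderBall {g : Cube m → ℝ} {G : EuclideanSpace ℝ (Fin m) → ℝ}
    {B r : ℝ} (h : SmoothHolder m β G B)
    (hg : ∀ x : Cube m, g x = G (WithLp.toLp 2 fun i => (x i : ℝ))) (hr : 2 * B ≤ r) :
    g ∈ holderBall m β r := by
  refine mem_holderBall_of_le hg h.nonneg (h.contDiff.of_le (by exact_mod_cast le_top)).contDiffOn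
    h.contDiff.continuous.continuousOn (fun k _ i => ?_) (fun k hk i x _ => ?_)
    (fun i x _ z _ => ?_) hr
  · have hcont : Continuous (partialDeriv G i) := by
      have := h.contDiff.continuous_iteratedFDeriv (m := k) (by exact_mod_cast le_top)
      unfold partialDeriv
      fun_prop
    exact ((isCompact_closedCube m).uniformContinuousOn_of_continuous hcont.continuousOn).mono
      (openCube_subset_closedCube m)
  · exact (norm_partialDeriv_le i _).trans (h.bound k hk x)
  · have := norm_partialDeriv_le i (iteratedFDeriv ℝ (⌈β⌉₊ - 1) G x -
      iteratedFDeriv ℝ (⌈β⌉₊ - 1) G z)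
    exact this.trans (h.holder x z)

/-- Interpolation: derivative bounds of a function varying at scale `1/M` give a Hölder bound. -/
theorem smoothHolder_of_deriv_bounds (hβ : 0 < β) {G : EuclideanSpace ℝ (Fin m) → ℝ} {B M : ℝ}
    (hM : 1 ≤ M) (hG : ContDiff ℝ ∞ G) (hB : 0 ≤ B)
    (h : ∀ k ≤ ⌈β⌉₊, ∀ x, ‖iteratedFDeriv ℝ k G x‖ ≤ B * M ^ ((k : ℝ) - β)) :
    SmoothHolder m β G (2 * B) := by
  have hM0 : 0 < M := by linarith
  have hceil : 1 ≤ ⌈β⌉₊ := Nat.one_le_iff_ne_zero.2 (Nat.ceil_pos.2 hβ).ne'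
  obtain ⟨l, hl⟩ : ∃ l, ⌈β⌉₊ = l + 1 := ⟨⌈β⌉₊ - 1, by omega⟩
  have hlβ : (l : ℝ) < β := Nat.lt_ceil.1 (by omega)
  have hβl : β ≤ l + 1 := by have := Nat.le_ceil β; rw [hl] at this; exact_mod_cast this
  refine ⟨hG, fun k hk x => ?_, fun x z => ?_⟩
  · have hkβ : (k : ℝ) - β ≤ 0 := by
      have : (k : ℝ) ≤ l := by exact_mod_cast (by omega : k ≤ l)
      linarith
    calc _ ≤ B * M ^ ((k : ℝ) - β) := h k (by omega) x
      _ ≤ B * 1 := mul_le_mul_of_nonneg_left (Real.rpow_le_one_of_one_le_of_nonpos hM hkβ) hB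
      _ ≤ 2 * B := by linarith
  · have e1 : ⌈β⌉₊ - 1 = l := by omega
    have e2 : β + 1 - (⌈β⌉₊ : ℝ) = β - l := by rw [hl]; push_cast; ring
    rw [e1, e2]
    set γ := β - l with hγ
    have hγ0 : 0 < γ := by linarith
    have hγ1 : γ ≤ 1 := by linarith
    set u := ‖x - z‖ with hu
    have hu0 : 0 ≤ u := norm_nonneg _
    have hMγ : 0 < M ^ (-γ) := Real.rpow_pos_of_pos hM0 _
    -- At distances up to `1/M` the mean value inequality uses the derivative of order `⌈β⌉`; beyond
    -- `1/M` the triangle inequality with the order `⌈β⌉ - 1` bound suffices.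
    by_cases hMu : M * u ≤ 1
    · have hlip : ‖iteratedFDeriv ℝ l G x - iteratedFDeriv ℝ l G z‖ ≤ B * M ^ (1 - γ) * ‖x - z‖ := by
        refine Convex.norm_image_sub_le_of_norm_fderiv_le (𝕜 := ℝ) (s := Set.univ)
          (fun y _ => ?_) (fun y _ => ?_) convex_univ trivial trivial
        · exact (hG.differentiable_iteratedFDeriv (m := l)
            (by exact_mod_cast WithTop.coe_lt_top l)) y
        · rw [norm_fderiv_iteratedFDeriv]
          convert h (l + 1) (by omega) y using 3
          rw [hγ]; push_cast; ring
      refine hlip.trans ?_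
      have h1 : M ^ (1 - γ) * u = M ^ (-γ) * (M * u) := by
        rw [sub_eq_add_neg, Real.rpow_add hM0, Real.rpow_one]; ring
      have h2 : M * u ≤ (M * u) ^ γ := by
        have := Real.rpow_le_rpow_of_exponent_ge_of_imp (mul_nonneg hM0.le hu0) hMu hγ1
          (fun _ h => absurd h one_ne_zero)
        rwa [Real.rpow_one] at this
      have h3 : M ^ (-γ) * (M * u) ^ γ = u ^ γ := by
        rw [Real.mul_rpow hM0.le hu0, ← mul_assoc, ← Real.rpow_add hM0]; simp
      calc B * M ^ (1 - γ) * u = B * (M ^ (-γ) * (M * u)) := by rw [mul_assoc, h1]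
        _ ≤ B * (M ^ (-γ) * (M * u) ^ γ) := by gcongr
        _ = B * u ^ γ := by rw [h3]
        _ ≤ 2 * B * u ^ γ := by nlinarith [Real.rpow_nonneg hu0 γ, mul_nonneg hB (Real.rpow_nonneg hu0 γ)]
    · have hMu := (not_le.1 hMu).le
      have hb : ∀ y, ‖iteratedFDeriv ℝ l G y‖ ≤ B * M ^ (-γ) := fun y => by
        convert h l (by omega) y using 3; rw [hγ]; ring
      have h3 : M ^ (-γ) ≤ u ^ γ := by
        have hinv : M⁻¹ ≤ u := by
          rw [inv_le_iff_one_le_mul₀' hM0]; exact hMu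
        rw [Real.rpow_neg hM0.le, ← Real.inv_rpow hM0.le]
        exact Real.rpow_le_rpow (inv_nonneg.2 hM0.le) hinv hγ0.le
      calc _ ≤ ‖iteratedFDeriv ℝ l G x‖ + ‖iteratedFDeriv ℝ l G z‖ := norm_sub_le _ _
        _ ≤ B * M ^ (-γ) + B * M ^ (-γ) := add_le_add (hb x) (hb z)
        _ = 2 * B * M ^ (-γ) := by ring
        _ ≤ 2 * B * u ^ γ := by gcongr

theorem exists_iteratedFDeriv_bound {E : Type*} [NormedAddCommGroup E] [NormedSpace ℝ E]
    {f : E → ℝ} (hf : ContDiff ℝ ∞ f) (hs : HasCompactSupport f) (N : ℕ) :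
    ∃ B, 0 < B ∧ ∀ k ≤ N, ∀ x, ‖iteratedFDeriv ℝ k f x‖ ≤ B := by
  have h : ∀ k : ℕ, ∃ C, ∀ x, ‖iteratedFDeriv ℝ k f x‖ ≤ C := fun k =>
    (hf.continuous_iteratedFDeriv (m := k) (by exact_mod_cast le_top)).bounded_above_of_compact_support
      (hs.iteratedFDeriv k)
  choose C hC using h
  have hC0 : ∀ k, 0 ≤ C k := fun k => (norm_nonneg _).trans (hC k 0)
  refine ⟨1 + ∑ k ∈ Finset.range (N + 1), C k,
    by linarith [Finset.sum_nonneg fun k (_ : k ∈ Finset.range (N + 1)) => hC0 k],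
    fun k hk x => (hC k x).trans ?_⟩
  have := Finset.single_le_sum (f := C) (fun k _ => hC0 k)
    (Finset.mem_range.2 (Nat.lt_succ_of_le hk))
  linarith

theorem norm_euclideanSpace_proj_le (i : Fin m) :
    ‖(EuclideanSpace.proj i : EuclideanSpace ℝ (Fin m) →L[ℝ] ℝ)‖ ≤ 1 :=
  ContinuousLinearMap.opNorm_le_bound _ zero_le_one fun x => by
    rw [one_mul]; exact PiLp.norm_apply_le x i

theorem norm_iteratedFDeriv_comp_clm_le {E F : Type*} [NormedAddCommGroup E] [NormedSpace ℝ E]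
    [NormedAddCommGroup F] [NormedSpace ℝ F] {f : F → ℝ} (hf : ContDiff ℝ ∞ f) (L : E →L[ℝ] F)
    (k : ℕ) (x : E) :
    ‖iteratedFDeriv ℝ k (fun x => f (L x)) x‖ ≤ ‖iteratedFDeriv ℝ k f (L x)‖ * ‖L‖ ^ k := by
  have := L.iteratedFDeriv_comp_right hf x (i := k) (by exact_mod_cast le_top)
  change ‖iteratedFDeriv ℝ k (f ∘ L) x‖ ≤ _
  rw [this]
  refine (ContinuousMultilinearMap.norm_compContinuousLinearMap_le _ _).trans ?_
  simp

/-- Dimension-free Hölder bound for functions of one coordinate. -/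
theorem exists_smoothHolder_coord (hβ : 0 < β) {f : ℝ → ℝ} (hf : ContDiff ℝ ∞ f)
    (hs : HasCompactSupport f) :
    ∃ B, 0 < B ∧ ∀ (m : ℕ) (i : Fin m), SmoothHolder m β (fun x => f (x i)) B := by
  obtain ⟨B, hB, h⟩ := exists_iteratedFDeriv_bound hf hs ⌈β⌉₊
  refine ⟨2 * B, by linarith, fun m i => ?_⟩
  -- Scale `M = 1`. Coordinate projections have norm at most `1`, so the bound does not depend on
  -- `m`.
  refine smoothHolder_of_deriv_bounds hβ le_rfl
    (hf.comp (EuclideanSpace.proj i : EuclideanSpace ℝ (Fin m) →L[ℝ] ℝ).contDiff)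
    hB.le fun k hk x => ?_
  rw [Real.one_rpow, mul_one]
  refine (norm_iteratedFDeriv_comp_clm_le hf
    (EuclideanSpace.proj i : EuclideanSpace ℝ (Fin m) →L[ℝ] ℝ) k x).trans ?_
  calc _ ≤ B * 1 := mul_le_mul (h k hk _) (pow_le_one₀ (norm_nonneg _)
        (norm_euclideanSpace_proj_le i)) (by positivity) hB.le
    _ = B := mul_one B

/-- Hölder bound for a sum of separated bumps of width `1/M` and height `c M^{-β}`. -/
theorem smoothHolder_sum_bumps (hβ : 0 < β) {ψ : EuclideanSpace ℝ (Fin m) → ℝ}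
    (hψ : ContDiff ℝ ∞ ψ) {B M c : ℝ} (hM : 1 ≤ M) (hc : 0 ≤ c)
    (hB : ∀ k ≤ ⌈β⌉₊, ∀ x, ‖iteratedFDeriv ℝ k ψ x‖ ≤ B)
    {ι : Type*} [Fintype ι] (p : ι → EuclideanSpace ℝ (Fin m)) (a : ι → ℝ) (ha : ∀ i, |a i| ≤ 1)
    (hsep : ∀ y i j, y - p i ∈ tsupport ψ → y - p j ∈ tsupport ψ → i = j) :
    SmoothHolder m β (fun x => ∑ i, (c * M ^ (-β) * a i) * ψ (M • x - p i)) (2 * (c * B)) := by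
  have hM0 : 0 < M := by linarith
  have hB0 : 0 ≤ B := (norm_nonneg _).trans (hB 0 (Nat.zero_le _) 0)
  set L : EuclideanSpace ℝ (Fin m) →L[ℝ] EuclideanSpace ℝ (Fin m) :=
    M • ContinuousLinearMap.id ℝ _ with hL
  have hLM : ‖L‖ ≤ M := by
    rw [hL, norm_smul, Real.norm_of_nonneg hM0.le]
    exact mul_le_of_le_one_right hM0.le ContinuousLinearMap.norm_id_le
  have hsh : ∀ i, ContDiff ℝ ∞ fun y => ψ (y - p i) := fun i =>
    hψ.comp (contDiff_id.sub contDiff_const)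
  have hterm : ∀ i, ContDiff ℝ ∞ fun x => ψ (M • x - p i) := fun i =>
    (hsh i).comp L.contDiff
  have hderiv : ∀ k i x, ‖iteratedFDeriv ℝ k (fun x => ψ (M • x - p i)) x‖ ≤
      ‖iteratedFDeriv ℝ k ψ (M • x - p i)‖ * M ^ k := fun k i x => by
    refine (norm_iteratedFDeriv_comp_clm_le (hsh i) L k x).trans ?_
    rw [iteratedFDeriv_comp_sub]
    exact mul_le_mul_of_nonneg_left (pow_le_pow_left₀ (norm_nonneg _) hLM k) (norm_nonneg _)
  refine smoothHolder_of_deriv_bounds hβ hM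
    (ContDiff.sum fun i _ => contDiff_const.mul (hterm i)) (mul_nonneg hc hB0) fun k hk x => ?_
  have hMβ : 0 < M ^ (-β) := Real.rpow_pos_of_pos hM0 _
  have hsum : iteratedFDeriv ℝ k (fun x => ∑ i, (c * M ^ (-β) * a i) * ψ (M • x - p i)) x =
      ∑ i, (c * M ^ (-β) * a i) • iteratedFDeriv ℝ k (fun x => ψ (M • x - p i)) x := by
    have h1 := iteratedFDeriv_sum_apply (𝕜 := ℝ) (u := (Finset.univ : Finset ι)) (n := k) (x := x)
      (f := fun i x => (c * M ^ (-β) * a i) * ψ (M • x - p i)) (fun i _ =>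
        ((contDiff_const.mul (hterm i)).of_le (by exact_mod_cast le_top)).contDiffAt)
    have h0 : (fun x => ∑ i, (c * M ^ (-β) * a i) * ψ (M • x - p i)) =
      ∑ i, fun x => (c * M ^ (-β) * a i) * ψ (M • x - p i) := by
      ext x; simp
    first
    | rw [h1]
    | rw [h0, h1]
    refine Finset.sum_congr rfl fun i _ => ?_
    exact iteratedFDeriv_const_smul_apply' (a := c * M ^ (-β) * a i)
      ((hterm i).of_le (by exact_mod_cast le_top)).contDiffAt
  have hbd : ∀ i, ‖(c * M ^ (-β) * a i) • iteratedFDeriv ℝ k (fun x => ψ (M • x - p i)) x‖ ≤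
      c * M ^ (-β) * (‖iteratedFDeriv ℝ k ψ (M • x - p i)‖ * M ^ k) := fun i => by
    rw [norm_smul, Real.norm_eq_abs, abs_mul, abs_of_nonneg (mul_nonneg hc hMβ.le)]
    have := mul_le_mul_of_nonneg_left (ha i) (mul_nonneg hc hMβ.le)
    exact mul_le_mul (by linarith) (hderiv k i x) (norm_nonneg _) (mul_nonneg hc hMβ.le)
  rw [hsum]
  have htarget : c * M ^ (-β) * (B * M ^ k) = c * B * M ^ ((k : ℝ) - β) := by
    rw [sub_eq_neg_add, Real.rpow_add hM0, Real.rpow_natCast]; ring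
  have hzero : ∀ i, M • x - p i ∉ tsupport ψ → iteratedFDeriv ℝ k ψ (M • x - p i) = 0 := fun i hi =>
    Function.notMem_support.1 fun h => hi (support_iteratedFDeriv_subset k h)
  -- By separation at most one bump is active at `x`, so the sum obeys the bound of a single bump
  -- whatever the number of cells.
  by_cases hex : ∃ i, M • x - p i ∈ tsupport ψ
  · obtain ⟨i, hi⟩ := hex
    calc _ ≤ ∑ j, c * M ^ (-β) * (‖iteratedFDeriv ℝ k ψ (M • x - p j)‖ * M ^ k) :=
          norm_sum_le_of_le _ fun j _ => hbd j
      _ = c * M ^ (-β) * (‖iteratedFDeriv ℝ k ψ (M • x - p i)‖ * M ^ k) := by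
          refine Finset.sum_eq_single i (fun j _ hj => ?_) (fun h => absurd (Finset.mem_univ i) h)
          rw [hzero j fun h => hj (hsep _ _ _ h hi)]; simp
      _ ≤ c * M ^ (-β) * (B * M ^ k) := by
          gcongr
          exact hB k hk _
      _ = _ := htarget
  · simp only [not_exists] at hex
    calc _ ≤ ∑ j, c * M ^ (-β) * (‖iteratedFDeriv ℝ k ψ (M • x - p j)‖ * M ^ k) :=
          norm_sum_le_of_le _ fun j _ => hbd j
      _ = 0 := Finset.sum_eq_zero fun j _ => by rw [hzero j (hex j)]; simp
      _ ≤ _ := by positivity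

end BinClass

namespace BinClass
open scoped ContDiff

/-! ### The signed power -/

/-- The signed power map of `[0,1]`, centred at `1/2` and fixing `0`, `1/2` and `1`. -/
noncomputable def signedPow (p t : ℝ) : ℝ := 1 / 2 + SignType.sign (2 * t - 1) * |2 * t - 1| ^ p / 2

theorem signedPow_one_exp (t : ℝ) : signedPow 1 t = t := by
  rw [signedPow, Real.rpow_one, sign_mul_abs]; ring

theorem signedPow_one {p : ℝ} : signedPow p 1 = 1 := by norm_num [signedPow]

theorem bitSign_eq (b : Bool) : bitSign b = 1 ∨ bitSign b = -1 := by cases b <;> simp [bitSign]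

theorem signedPow_half_add {p e : ℝ} (he : 0 < e) (b : Bool) :
    signedPow p (1 / 2 + bitSign b * e) = 1 / 2 + bitSign b * ((2 * e) ^ p / 2) := by
  have h : 2 * (1 / 2 + bitSign b * e) - 1 = bitSign b * (2 * e) := by ring
  rw [signedPow, h]
  rcases bitSign_eq b with hb | hb <;> rw [hb]
  · rw [one_mul, sign_pos (by linarith), abs_of_pos (by linarith)]; simp
  · rw [neg_one_mul, sign_neg (by linarith), abs_neg, abs_of_pos (by linarith)]; simp; ring

/-- In terms of the margin `2e`, each application is raising to the power `p`. This is the source of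
`(1 ∧ β)^q` in the rate. -/
theorem iterate_signedPow_half_add {p : ℝ} (b : Bool) (q : ℕ) {e : ℝ} (he : 0 < e) :
    (signedPow p)^[q] (1 / 2 + bitSign b * e) = 1 / 2 + bitSign b * ((2 * e) ^ (p ^ q) / 2) := by
  induction q generalizing e with
  | zero => simp
  | succ q ih =>
    rw [Function.iterate_succ_apply, signedPow_half_add he, ih (by positivity)]
    have : 2 * ((2 * e) ^ p / 2) = (2 * e) ^ p := by ring
    rw [this, ← Real.rpow_mul (by positivity), pow_succ']

theorem signedPow_mem {p t : ℝ} (hp : 0 ≤ p) (ht : t ∈ Set.Icc (0 : ℝ) 1) :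
    signedPow p t ∈ Set.Icc (0 : ℝ) 1 := by
  have h : |2 * t - 1| ≤ 1 := abs_le.2 ⟨by linarith [ht.1], by linarith [ht.2]⟩
  have h1 := Real.rpow_le_one (abs_nonneg (2 * t - 1)) h hp
  have h0 := Real.rpow_nonneg (abs_nonneg (2 * t - 1)) p
  unfold signedPow
  rcases lt_trichotomy (2 * t - 1) 0 with h | h | h
  · rw [sign_neg h]; simp; constructor <;> linarith
  · rw [h]; norm_num
  · rw [sign_pos h]; simp; constructor <;> linarith

theorem iterate_signedPow_mem {p t : ℝ} (hp : 0 ≤ p) (q : ℕ) (ht : t ∈ Set.Icc (0 : ℝ) 1) :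
    (signedPow p)^[q] t ∈ Set.Icc (0 : ℝ) 1 := by
  induction q generalizing t with
  | zero => exact ht
  | succ q ih => rw [Function.iterate_succ_apply]; exact ih (signedPow_mem hp ht)

/-- Subadditivity of `t ↦ t^p` on the nonnegative reals for `p ≤ 1`. -/
theorem abs_rpow_sub_rpow_le_rpow_abs_sub {p x y : ℝ} (hp : 0 < p) (hp1 : p ≤ 1) (hx : 0 ≤ x)
    (hy : 0 ≤ y) : |x ^ p - y ^ p| ≤ |x - y| ^ p := by
  have key : ∀ x y : ℝ, 0 ≤ y → y ≤ x → |x ^ p - y ^ p| ≤ |x - y| ^ p := fun x y hy h => by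
    have h1 := Real.rpow_add_le_add_rpow (sub_nonneg.2 h) hy hp.le hp1
    rw [sub_add_cancel] at h1
    rw [abs_of_nonneg (sub_nonneg.2 (Real.rpow_le_rpow hy h hp.le)), abs_of_nonneg (sub_nonneg.2 h)]
    linarith
  rcases le_total y x with h | h
  · exact key x y hy h
  · rw [abs_sub_comm, abs_sub_comm x]; exact key y x hx h

/-- Oddness reduces to `x ≥ 0`. For equal signs use subadditivity; for opposite signs both `|x|` and
`|y|` are at most `|x - y|`, which costs the factor `2`. -/
theorem abs_signed_rpow_sub_le {p : ℝ} (hp : 0 < p) (hp1 : p ≤ 1) (x y : ℝ) :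
    |SignType.sign x * |x| ^ p - SignType.sign y * |y| ^ p| ≤ 2 * |x - y| ^ p := by
  have key : ∀ x y : ℝ, 0 ≤ x →
      |SignType.sign x * |x| ^ p - SignType.sign y * |y| ^ p| ≤ 2 * |x - y| ^ p := by
    intro x y hx
    have ex : ∀ x : ℝ, 0 ≤ x → SignType.sign x * |x| ^ p = x ^ p := fun x hx => by
      rcases hx.eq_or_lt with rfl | h
      · simp [Real.zero_rpow hp.ne']
      · rw [sign_pos h, abs_of_pos h]; simp
    rw [ex x hx]
    have hn := Real.rpow_nonneg (abs_nonneg (x - y)) p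
    rcases le_or_gt 0 y with hy | hy
    · rw [ex y hy]
      linarith [abs_rpow_sub_rpow_le_rpow_abs_sub hp hp1 hx hy]
    · rw [sign_neg hy, abs_of_neg hy]
      have h1 : x ^ p ≤ |x - y| ^ p := Real.rpow_le_rpow hx
        (by rw [abs_of_nonneg (by linarith)]; linarith) hp.le
      have h2 : (-y) ^ p ≤ |x - y| ^ p := Real.rpow_le_rpow (by linarith)
        (by rw [abs_of_nonneg (by linarith)]; linarith) hp.le
      have h3 := Real.rpow_nonneg hx p
      have h4 := Real.rpow_nonneg (show 0 ≤ -y by linarith) p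
      simp only [SignType.coe_neg_one]
      rw [abs_of_nonneg (by linarith)]; linarith
  rcases le_total 0 x with hx | hx
  · exact key x y hx
  · have h := key (-x) (-y) (by linarith)
    rw [Left.sign_neg, Left.sign_neg, abs_neg, abs_neg] at h
    have e1 : -x - -y = -(x - y) := by ring
    rw [e1, abs_neg] at h
    push_cast at h
    have e2 : -(SignType.sign x : ℝ) * |x| ^ p - -(SignType.sign y : ℝ) * |y| ^ p =
      -(SignType.sign x * |x| ^ p - SignType.sign y * |y| ^ p) := by ring
    rwa [e2, abs_neg] at h

theorem abs_signedPow_sub_le {p : ℝ} (hp : 0 < p) (hp1 : p ≤ 1) (t u : ℝ) :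
    |signedPow p t - signedPow p u| ≤ 2 * |t - u| ^ p := by
  have h := abs_signed_rpow_sub_le hp hp1 (2 * t - 1) (2 * u - 1)
  have e1 : 2 * t - 1 - (2 * u - 1) = 2 * (t - u) := by ring
  rw [e1, abs_mul, Real.mul_rpow (by norm_num) (abs_nonneg _)] at h
  have h2 : |(2 : ℝ)| ^ p ≤ 2 := by
    rw [abs_of_pos (by norm_num : (0 : ℝ) < 2)]
    calc (2 : ℝ) ^ p ≤ 2 ^ (1 : ℝ) := Real.rpow_le_rpow_of_exponent_le (by norm_num) hp1
      _ = 2 := Real.rpow_one 2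
  have e2 : signedPow p t - signedPow p u = (SignType.sign (2 * t - 1) * |2 * t - 1| ^ p -
      SignType.sign (2 * u - 1) * |2 * u - 1| ^ p) / 2 := by unfold signedPow; ring
  rw [e2, abs_div, abs_of_pos (by norm_num : (0 : ℝ) < 2)]
  have := mul_le_mul_of_nonneg_right h2 (Real.rpow_nonneg (abs_nonneg (t - u)) p)
  linarith

theorem continuous_signedPow {p : ℝ} (hp : 0 < p) (hp1 : p ≤ 1) : Continuous (signedPow p) := by
  rw [continuous_iff_continuousAt]
  intro t
  refine tendsto_iff_dist_tendsto_zero.2 ?_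
  have h : Filter.Tendsto (fun u => 2 * |u - t| ^ p) (nhds t) (nhds 0) := by
    have : Continuous fun u : ℝ => 2 * |u - t| ^ p := by
      have := Real.continuous_rpow_const hp.le
      fun_prop
    convert this.tendsto t using 2
    simp [Real.zero_rpow hp.ne']
  exact squeeze_zero (fun _ => dist_nonneg) (fun u => abs_signedPow_sub_le hp hp1 u t) h

variable {β : ℝ}

/-! ### Hölder functions of one coordinate -/

/-- A fixed smooth cutoff, equal to `1` on `[-2,2]`. -/
noncomputable def cutoff : ContDiffBump (0 : ℝ) := ⟨2, 3, by norm_num, by norm_num⟩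

theorem cutoff_eq_one {t : ℝ} (h0 : 0 ≤ t) (h1 : t ≤ 1) : cutoff t = 1 := by
  refine cutoff.one_of_mem_closedBall ?_
  rw [mem_closedBall_zero_iff, Real.norm_eq_abs, abs_of_nonneg h0]
  show t ≤ 2
  linarith

/-- The derivatives of `f` may be unbounded on the line. The cutoff makes the support compact
without changing `f` on `[0,1]`, the only range that matters on the cube. -/
theorem exists_smoothHolder_cutoff (hβ : 0 < β) {f : ℝ → ℝ} (hf : ContDiff ℝ ∞ f) :
    ∃ B, 0 < B ∧ ∀ (m : ℕ) (i : Fin m), SmoothHolder m β (fun x => cutoff (x i) * f (x i)) B :=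
  exists_smoothHolder_coord hβ (f := fun t => cutoff t * f t) (cutoff.contDiff.mul hf)
    cutoff.hasCompactSupport.mul_right

theorem exists_holderBall_coord (hβ : 0 < β) {f : ℝ → ℝ} (hf : ContDiff ℝ ∞ f) :
    ∃ c, 0 < c ∧ ∀ (r : ℝ) (m : ℕ) (i : Fin m), c ≤ r →
      (fun y : Cube m => f (y i)) ∈ holderBall m β r := by
  obtain ⟨B, hB, h⟩ := exists_smoothHolder_cutoff hβ hf
  refine ⟨2 * B, by linarith, fun r m i hr => (h m i).mem_holderBall (fun x => ?_) hr⟩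
  simp [cutoff_eq_one (x i).2.1 (x i).2.2]

/-- For `β > 1` the exponent is `1` and the map is the identity. For `β ≤ 1` one has `⌈β⌉ = 1`, so
no derivatives enter and only the `β`-Hölder estimate is required, despite the kink at `1/2`. -/
theorem exists_holderBall_signedPow (hβ : 0 < β) :
    ∃ c, 0 < c ∧ ∀ (r : ℝ) (m : ℕ) (i : Fin m), c ≤ r →
      (fun y : Cube m => signedPow (min 1 β) (y i)) ∈ holderBall m β r := by
  rcases lt_or_ge 1 β with h1 | h1
  · rw [min_eq_left h1.le]
    simp_rw [signedPow_one_exp]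
    exact exists_holderBall_coord hβ contDiff_id
  · rw [min_eq_right h1]
    refine ⟨4, by norm_num, fun r m i hr => ?_⟩
    have hceil : ⌈β⌉₊ = 1 := by
      rw [Nat.ceil_eq_iff (by norm_num)]; norm_num; exact ⟨hβ, h1⟩
    have hcont : Continuous fun x : EuclideanSpace ℝ (Fin m) => signedPow β (x i) := by
      have := continuous_signedPow hβ h1
      fun_prop
    have hp : ∀ k, k = 0 → ∀ j : Fin k → Fin m, partialDeriv
        (fun x : EuclideanSpace ℝ (Fin m) => signedPow β (x i)) j = fun x => signedPow β (x i) := by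
      rintro k rfl j
      funext x
      simp [partialDeriv]
    refine mem_holderBall_of_le (G := fun x => signedPow β (x i)) (B := 2) (fun x => rfl)
      (by norm_num) ?_ hcont.continuousOn (fun k hk j => ?_) (fun k hk j x hx => ?_)
      (fun j x hx z hz => ?_) (by linarith)
    · rw [hceil]
      simpa using (contDiffOn_zero (𝕜 := ℝ)).2 hcont.continuousOn
    · rw [hp k (by omega)]
      exact ((isCompact_closedCube m).uniformContinuousOn_of_continuous hcont.continuousOn).mono
        (openCube_subset_closedCube m)
    · rw [hp k (by omega)]
      have := signedPow_mem hβ.le (Set.Ioo_subset_Icc_self (hx i))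
      rw [abs_of_nonneg this.1]; linarith [this.2]
    · rw [hp _ (by omega)]
      have e : β + 1 - (⌈β⌉₊ : ℝ) = β := by rw [hceil]; push_cast; ring
      rw [e]
      refine (abs_signedPow_sub_le hβ h1 _ _).trans ?_
      have := PiLp.norm_apply_le (x - z) i
      rw [Real.norm_eq_abs] at this
      exact mul_le_mul_of_nonneg_left (Real.rpow_le_rpow (abs_nonneg _) this hβ.le) (by norm_num)

/-- The innermost map repeats `f` in all `K` components; the next layer reads one of them and
applies the signed power, which is again a sparse function, now on `[0,1]^K`. Selecting `dstar` of
`K` variables needs `dstar ≤ K`, but only when there is such a layer. -/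
theorem iterate_signedPow_comp_mem_compClass {K dstar : ℕ} {β r p : ℝ} (hp : 0 ≤ p)
    (hs : 1 ≤ dstar)
    (hφ : ∀ i : Fin dstar, (fun y : Cube dstar => signedPow p (y i)) ∈ holderBall dstar β r) :
    ∀ (q d : ℕ), (q = 0 ∨ dstar ≤ K) → ∀ f ∈ sparseHolder d dstar β r,
      (∀ x, f x ∈ Set.Icc (0 : ℝ) 1) →
      (fun x => (signedPow p)^[q] (f x)) ∈ compClass K dstar β r q d
  | 0, _, _, f, hf, _ => hf
  | q + 1, d, hq, f, hf, h01 => by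
    have hK : dstar ≤ K := hq.resolve_left (Nat.succ_ne_zero q)
    let i0 : Fin dstar := ⟨0, hs⟩
    refine ⟨fun x _ => ⟨f x, h01 x⟩,
      fun y => (signedPow p)^[q] (signedPow p (y (Fin.castLEOrderEmb hK i0))), fun _ => hf, ?_, rfl⟩
    refine iterate_signedPow_comp_mem_compClass hp hs hφ q K (Or.inr hK)
      (fun y => signedPow p (y (Fin.castLEOrderEmb hK i0)))
      ⟨Fin.castLEOrderEmb hK, _, hφ i0, fun x => rfl⟩ fun y => ?_
    exact signedPow_mem hp (y _).2

end BinClass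

/-! ### Input distributions and the reduction to cells -/

namespace BinClass
open scoped ContDiff

variable {d : ℕ}

/-- A probability measure with prescribed masses on finitely many disjoint sets, uniform on each. -/
theorem exists_boundedDensity {ι : Type*} [Fintype ι] {Λ : ℝ} (hΛ : 0 ≤ Λ)
    (A : ι → Set (Cube d)) (hA : ∀ i, MeasurableSet (A i))
    (hdisj : Pairwise (Function.onFun Disjoint A)) (v : ι → ℝ) (hv : ∀ i, 0 ≤ v i)
    (hpos : ∀ i, 0 < volume.real (A i)) (hvΛ : ∀ i, v i ≤ Λ * volume.real (A i))
    (hsum : ∑ i, v i = 1) :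
    ∃ Q : Measure (Cube d), Q ∈ boundedDensity d Λ ∧ (∀ i, Q (A i) = ENNReal.ofReal (v i)) ∧
      ∀ᵐ x ∂Q, ∃ i, x ∈ A i := by
  classical
  set f : Cube d → ℝ := fun x => ∑ i, (A i).indicator (fun _ => v i / volume.real (A i)) x with hf
  have hfm : Measurable f := Finset.measurable_sum _ fun i _ => measurable_const.indicator (hA i)
  have hfA : ∀ i, ∀ x ∈ A i, f x = v i / volume.real (A i) := fun i x hx => by
    simp only [hf]
    rw [Finset.sum_eq_single i, Set.indicator_of_mem hx]
    · intro j _ hj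
      exact Set.indicator_of_notMem (fun hxj => Set.disjoint_left.1 (hdisj hj) hxj hx) _
    · exact fun h => absurd (Finset.mem_univ i) h
  have hf0 : ∀ x, (¬ ∃ i, x ∈ A i) → f x = 0 := fun x hx =>
    Finset.sum_eq_zero fun i _ => Set.indicator_of_notMem (fun h => hx ⟨i, h⟩) _
  set Q := (volume : Measure (Cube d)).withDensity fun x => ENNReal.ofReal (f x) with hQ
  have hQA : ∀ i, Q (A i) = ENNReal.ofReal (v i) := fun i => by
    rw [hQ, withDensity_apply _ (hA i), setLIntegral_congr_fun (hA i)
      (g := fun _ => ENNReal.ofReal (v i / volume.real (A i))) fun x hx => by rw [hfA i x hx],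
      setLIntegral_const, ← ofReal_measureReal, ← ENNReal.ofReal_mul (div_nonneg (hv i) (hpos i).le),
      div_mul_cancel₀ _ (hpos i).ne']
  have hae : ∀ᵐ x ∂Q, ∃ i, x ∈ A i := by
    have hU : MeasurableSet (⋃ i, A i) := MeasurableSet.iUnion hA
    have h0 : Q (⋃ i, A i)ᶜ = 0 := by
      rw [hQ, withDensity_apply _ hU.compl, setLIntegral_congr_fun hU.compl (g := fun _ => 0)
        fun x hx => by
          rw [hf0 x (by simpa using hx), ENNReal.ofReal_zero]]
      simp
    have := measure_eq_zero_iff_ae_notMem.1 h0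
    filter_upwards [this] with x hx
    simpa using hx
  have hprob : IsProbabilityMeasure Q := by
    refine ⟨?_⟩
    have h1 : Q Set.univ = Q (⋃ i, A i) := measure_congr (by
      filter_upwards [hae] with x hx
      have : x ∈ ⋃ i, A i := by simpa using hx
      exact propext ⟨fun _ => this, fun _ => trivial⟩)
    rw [h1, measure_iUnion hdisj hA, tsum_fintype]
    simp_rw [hQA]
    rw [← ENNReal.ofReal_sum_of_nonneg fun i _ => hv i, hsum, ENNReal.ofReal_one]
  refine ⟨Q, ⟨hprob, f, hfm, fun x => ?_, rfl⟩, hQA, hae⟩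
  by_cases hx : ∃ i, x ∈ A i
  · obtain ⟨i, hi⟩ := hx
    rw [hfA i x hi]
    exact ⟨div_nonneg (hv i) (hpos i).le, (div_le_iff₀ (hpos i)).2 (hvΛ i)⟩
  · rw [hf0 x hx]; exact ⟨le_rfl, hΛ⟩

theorem volume_real_Icc_unitInterval (l u : ℝ) (hl : 0 ≤ l) (hlu : l ≤ u) (hu : u ≤ 1) :
    (volume : Measure unitInterval).real {t | (t : ℝ) ∈ Set.Icc l u} = u - l := by
  have : ((↑) : unitInterval → ℝ) '' {t | (t : ℝ) ∈ Set.Icc l u} = Set.Icc l u := by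
    ext t
    constructor
    · rintro ⟨t, ht, rfl⟩; exact ht
    · intro ht; exact ⟨⟨t, hl.trans ht.1, ht.2.trans hu⟩, ht, rfl⟩
  rw [Measure.real, unitInterval.volume_apply, this, Real.volume_Icc,
    ENNReal.toReal_ofReal (by linarith)]

theorem measurableSet_coord_mem {d : ℕ} (i : Fin d) (l u : ℝ) :
    MeasurableSet {x : Cube d | (x i : ℝ) ∈ Set.Icc l u} :=
  ((measurable_subtype_coe.comp (measurable_pi_apply i)) measurableSet_Icc)

theorem volume_real_coord_mem {d : ℕ} (i : Fin d) (l u : ℝ) (hl : 0 ≤ l) (hlu : l ≤ u)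
    (hu : u ≤ 1) : (volume : Measure (Cube d)).real {x | (x i : ℝ) ∈ Set.Icc l u} = u - l := by
  have h := measurePreserving_eval (fun _ : Fin d => (volume : Measure unitInterval)) i
  have hm : MeasurableSet {t : unitInterval | (t : ℝ) ∈ Set.Icc l u} :=
    measurable_subtype_coe measurableSet_Icc
  have := h.measure_preimage hm.nullMeasurableSet
  rw [← volume_real_Icc_unitInterval l u hl hlu hu, Measure.real, Measure.real, ← this]
  rfl

theorem volume_real_box {k e : ℕ} (l u : Fin k → ℝ) {θ : ℝ} (hl : ∀ i, 0 ≤ l i)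
    (hu : ∀ i, u i ≤ 1) (hθ : 0 ≤ θ) (hlu : ∀ i, u i - l i = θ) :
    (volume : Measure (Cube (k + e))).real
      {x | ∀ i, (x (Fin.castAdd e i) : ℝ) ∈ Set.Icc (l i) (u i)} = θ ^ k := by
  have hset : {x : Cube (k + e) | ∀ i, (x (Fin.castAdd e i) : ℝ) ∈ Set.Icc (l i) (u i)} =
      Set.univ.pi (Fin.append (fun i => {t : unitInterval | (t : ℝ) ∈ Set.Icc (l i) (u i)})
        (fun _ : Fin e => Set.univ)) := by
    ext x
    simp only [Set.mem_ofPred_eq, Set.mem_univ_pi]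
    constructor
    · intro h j
      refine Fin.addCases (fun i => ?_) (fun i => ?_) j
      · rw [Fin.append_left]; exact h i
      · rw [Fin.append_right]; trivial
    · intro h i
      have := h (Fin.castAdd e i)
      rwa [Fin.append_left] at this
  rw [hset, Measure.real, volume_pi_pi, ENNReal.toReal_prod, Fin.prod_univ_add]
  simp only [Fin.append_left, Fin.append_right, measure_univ, ENNReal.toReal_one,
    Finset.prod_const_one, mul_one]
  calc _ = ∏ _i : Fin k, θ := Finset.prod_congr rfl fun i _ => by
          rw [← hlu i]
          exact volume_real_Icc_unitInterval _ _ (hl i) (by linarith [hlu i]) (hu i)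
    _ = θ ^ k := by simp

/-- The minimax lower bound from a family of sparse functions that are indexed by bits, deviate by
`± e` from `1/2` on disjoint cells, and equal `1` on a further set. -/
theorem le_minimaxRisk_of_cells {ι : Type*} [Fintype ι] [DecidableEq ι] {q K dstar n : ℕ}
    {α β r Λ e w : ℝ} {τ s : ℝ≥0∞} (hn : 1 ≤ n) (hα : 0 < α) (hβ : 0 < β) (hΛ : 1 < Λ)
    (hατ : ¬ (α < 1 ∧ 1 ≤ τ)) (hs : 1 ≤ dstar) (hK : dstar * q ≤ K * q)
    (hφ : ∀ i : Fin dstar, (fun y : Cube dstar => signedPow (min 1 β) (y i)) ∈ holderBall dstar β r)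
    (H : (ι → Bool) → Cube d → ℝ) (hH : ∀ σ, H σ ∈ sparseHolder d dstar β r)
    (hHm : ∀ σ, Measurable (H σ)) (hH01 : ∀ σ x, H σ x ∈ Set.Icc (0 : ℝ) 1)
    (A : ι → Set (Cube d)) (E : Set (Cube d)) (hA : ∀ i, MeasurableSet (A i))
    (hE : MeasurableSet E) (hdisj : Pairwise (Function.onFun Disjoint A))
    (hAE : ∀ i, Disjoint (A i) E)
    (hHA : ∀ σ i, ∀ x ∈ A i, H σ x = 1 / 2 + bitSign (σ i) * e) (hHE : ∀ σ, ∀ x ∈ E, H σ x = 1)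
    (he : 0 < e) (he1 : 2 * e ≤ 1) (hw : 0 < w) (hw1 : Fintype.card ι * w ≤ 1)
    (hwA : ∀ i, w ≤ Λ * volume.real (A i)) (hEvol : 1 ≤ Λ * volume.real E)
    (hs_one : s = ⊤ → (2 * e) ^ (min 1 β ^ q) = 1)
    (hsα : s ≠ ⊤ → Fintype.card ι * w ≤ α * ((2 * e) ^ (min 1 β ^ q)) ^ s.toReal)
    (hwn : w * ((2 * e) ^ (min 1 β ^ q)) ^ 2 ≤ 1 / (2 * n)) :
    ENNReal.ofReal (Fintype.card ι * w * (2 * e) ^ (min 1 β ^ q) / 16) ≤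
      minimaxRisk d n (compDistr d q K dstar β r Λ ∩ noiseClass d s α τ) := by
  set p := min 1 β with hp
  have hp0 : 0 < p := lt_min one_pos hβ
  have hp1 : p ≤ 1 := min_le_left _ _
  set ε := (2 * e) ^ (p ^ q) with hε
  have hε0 : 0 < ε := Real.rpow_pos_of_pos (by linarith) _
  have hε1 : ε ≤ 1 := Real.rpow_le_one (by linarith) he1 (by positivity)
  have hqK : q = 0 ∨ dstar ≤ K := by
    rcases Nat.eq_zero_or_pos q with h | h
    · exact Or.inl h
    · exact Or.inr (Nat.le_of_mul_le_mul_right hK h)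
  have hΛ0 : 0 < Λ := by linarith
  -- The set `E` joins the cells as index `none` and receives the mass left over; `1 ≤ Λ *
  -- volume.real E` ensures it has room for it.
  let A' : Option ι → Set (Cube d) := fun o => o.elim E A
  let v : Option ι → ℝ := fun o => o.elim (1 - Fintype.card ι * w) fun _ => w
  have hE0 : 0 < volume.real E := by
    by_contra h
    nlinarith [not_lt.1 h]
  obtain ⟨Q, hQΛ, hQA, hae⟩ := exists_boundedDensity hΛ0.le A'
    (fun o => by cases o <;> [exact hE; exact hA _])
    (fun o o' hoo => by
      cases o <;> cases o'
      · exact absurd rfl hoo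
      · exact (hAE _).symm
      · exact hAE _
      · exact hdisj fun h => hoo (congrArg some h))
    v (fun o => by cases o <;> [exact sub_nonneg.2 hw1; exact hw.le])
    (fun o => by
      cases o with
      | none => exact hE0
      | some i =>
        by_contra h
        have h1 := hwA i
        change ¬ 0 < volume.real (A i) at h
        nlinarith [not_lt.1 h])
    (fun o => by
      cases o with
      | none =>
        have : 0 ≤ Fintype.card ι * w := by positivity
        change 1 - Fintype.card ι * w ≤ Λ * volume.real E
        linarith
      | some i => exact hwA i)
    (by simp [v, Fintype.sum_option])
  have hQ : IsProbabilityMeasure Q := hQΛ.1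
  let η : (ι → Bool) → Cube d → ℝ := fun σ x => (signedPow p)^[q] (H σ x)
  have hηm : ∀ σ, Measurable (η σ) := fun σ =>
    (((continuous_signedPow hp0 hp1).iterate q).measurable).comp (hHm σ)
  have hη01 : ∀ σ x, η σ x ∈ Set.Icc (0 : ℝ) 1 := fun σ x =>
    iterate_signedPow_mem hp0.le q (hH01 σ x)
  have hηA : ∀ σ i, ∀ x ∈ A i, η σ x = 1 / 2 + bitSign (σ i) * ε / 2 := fun σ i x hx => by
    simp only [η]
    rw [hHA σ i x hx, iterate_signedPow_half_add _ _ he, mul_div_assoc]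
  have hηE : ∀ σ, ∀ x ∈ E, η σ x = 1 := fun σ x hx => by
    simp only [η]
    rw [hHE σ x hx]
    exact Function.iterate_fixed signedPow_one q
  let P : (ι → Bool) → ProbabilityMeasure (Cube d × Label) := fun σ =>
    ⟨jointLaw (η σ) Q, isProbabilityMeasure_jointLaw Q (hηm σ) (hη01 σ)⟩
  have hsplit : ∀ᵐ x ∂Q, (∃ i, x ∈ A i) ∨ x ∈ E := by
    filter_upwards [hae] with x hx
    obtain ⟨o, ho⟩ := hx
    cases o with
    | none => exact Or.inr ho
    | some i => exact Or.inl ⟨i, ho⟩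
  refine le_minimaxRisk hn Q A hA hdisj η hηm hη01 hε0 hε1 hw (fun i => hQA (some i)) hηA ?_ hwn _ P
    (fun σ => rfl) fun σ => ⟨⟨η σ, Q, ?_, hηm σ, hη01 σ, hQΛ, rfl⟩, ?_⟩
  · filter_upwards [hsplit] with x hx
    exact hx.imp id fun h σ => hηE σ x h
  · exact iterate_signedPow_comp_mem_compClass hp0.le hs hφ q d hqK (H σ) (hH σ) (hH01 σ)
  · refine mem_noiseClass (P σ) Q (hηm σ) (hη01 σ) rfl (B := ⋃ i, A i) hε0 hα hατ ?_ ?_ hs_one ?_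
    · intro x hx
      obtain ⟨i, hi⟩ := Set.mem_iUnion.1 hx
      rw [hηA σ i x hi]
      have : 2 * (1 / 2 + bitSign (σ i) * ε / 2) - 1 = bitSign (σ i) * ε := by ring
      rw [this]
      rcases bitSign_eq (σ i) with h | h <;> simp [h, abs_of_pos hε0]
    · filter_upwards [hsplit] with x hx
      refine hx.imp (fun ⟨i, hi⟩ => Set.mem_iUnion.2 ⟨i, hi⟩) fun h => ?_
      rw [hηE σ x h]; norm_num
    · intro hst
      rw [measure_iUnion hdisj hA, tsum_fintype]
      have : ∀ i, Q (A i) = ENNReal.ofReal w := fun i => hQA (some i)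
      simp_rw [this]
      rw [Finset.sum_const, Finset.card_univ, nsmul_eq_mul, ← ENNReal.ofReal_natCast,
        ← ENNReal.ofReal_mul (by positivity)]
      exact ENNReal.ofReal_le_ofReal (hsα hst)

end BinClass

/-! ### Transition function, the case of infinite noise exponent, bumps -/

namespace BinClass
open scoped ContDiff

/-- A smooth transition from `0` on `(-∞, a]` to `1` on `[2a, ∞)`. -/
noncomputable def transition (a t : ℝ) : ℝ := Real.smoothTransition (t / a - 1)

theorem contDiff_transition (a : ℝ) : ContDiff ℝ ∞ (transition a) :=
  Real.smoothTransition.contDiff.comp ((contDiff_id.div_const a).sub contDiff_const)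

theorem transition_mem (a t : ℝ) : transition a t ∈ Set.Icc (0 : ℝ) 1 :=
  ⟨Real.smoothTransition.nonneg _, Real.smoothTransition.le_one _⟩

theorem transition_of_le {a t : ℝ} (ha : 0 < a) (ht : t ≤ a) : transition a t = 0 :=
  Real.smoothTransition.zero_of_nonpos (by have := (div_le_one ha).2 ht; linarith)

theorem transition_of_ge {a t : ℝ} (ha : 0 < a) (ht : 2 * a ≤ t) : transition a t = 1 :=
  Real.smoothTransition.one_of_one_le (by have := (le_div_iff₀ ha).2 ht; linarith)

/-- The Hölder balls of radius at least `c` contain the one-coordinate functions that occur in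
the construction, whatever the dimension. -/
def IsHolderConst (β a c : ℝ) : Prop := ∀ r, c ≤ r → ∀ (m : ℕ) (i : Fin m),
  (fun y : Cube m => signedPow (min 1 β) (y i)) ∈ holderBall m β r ∧
  (fun y : Cube m => transition a (y i)) ∈ holderBall m β r ∧
  (fun _ : Cube m => (1 : ℝ)) ∈ holderBall m β r ∧
  ∃ B, 2 * (B + 1) ≤ r ∧
    SmoothHolder m β (fun x => cutoff (x i) * (1 / 2 + transition a (x i) / 2)) B

/-- All functions concerned depend on one coordinate, so the constant is uniform in the dimension.
The summand `1` in `2 * (B + 1)` reserves room for adding the bumps, whose Hölder bound will be at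
most `1`. -/
theorem exists_isHolderConst {β : ℝ} (hβ : 0 < β) (a : ℝ) : ∃ c, 0 < c ∧ IsHolderConst β a c := by
  obtain ⟨c1, h1, H1⟩ := exists_holderBall_signedPow hβ
  obtain ⟨c2, h2, H2⟩ := exists_holderBall_coord hβ (contDiff_transition a)
  obtain ⟨c3, h3, H3⟩ := exists_holderBall_coord hβ (f := fun _ => 1) contDiff_const
  obtain ⟨B, hB, H4⟩ := exists_smoothHolder_cutoff hβ
    (f := fun t => 1 / 2 + transition a t / 2)
    (contDiff_const.add ((contDiff_transition a).div_const 2))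
  exact ⟨c1 + c2 + c3 + 2 * (B + 1), by linarith, fun r hr m i => ⟨H1 r m i (by linarith),
    H2 r m i (by linarith), H3 r m i (by linarith), B, by linarith, H4 m i⟩⟩

theorem measurable_of_mem_holderBall {m : ℕ} {β r : ℝ} {g : Cube m → ℝ}
    (hg : g ∈ holderBall m β r) : Measurable g := by
  obtain ⟨G, hG, hc, -⟩ := hg
  have hemb : Continuous fun x : Cube m => (WithLp.toLp 2 fun i => (x i : ℝ) :
      EuclideanSpace ℝ (Fin m)) :=
    (PiLp.continuous_toLp 2 _).comp (by fun_prop)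
  have : Continuous g := by
    rw [show g = fun x => G (WithLp.toLp 2 fun i => (x i : ℝ)) from funext hG]
    exact hc.comp_continuous hemb fun x i => (x i).2
  exact this.measurable

theorem measurable_of_mem_sparseHolder {d m : ℕ} {β r : ℝ} {f : Cube d → ℝ}
    (hf : f ∈ sparseHolder d m β r) : Measurable f := by
  obtain ⟨I, g, hg, hfg⟩ := hf
  rw [funext hfg]
  exact (measurable_of_mem_holderBall hg).comp
    (measurable_pi_lambda _ fun j => measurable_pi_apply (I j))

/-- The lower bound `1 / (32 n)` under the strongest noise condition. -/
theorem le_minimaxRisk_top {d q K dstar n : ℕ} {α β r Λ a : ℝ} {τ : ℝ≥0∞} (hn : 1 ≤ n)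
    (hα : 0 < α) (hβ : 0 < β) (hΛ : 1 < Λ) (hατ : ¬ (α < 1 ∧ 1 ≤ τ)) (hs : 1 ≤ dstar)
    (hd : dstar ≤ d) (hK : dstar * q ≤ K * q) (ha : a = (Λ - 1) / (2 * Λ))
    {c : ℝ} (hc : IsHolderConst β a c) (hr : c ≤ r) (han : 1 / a ≤ n) :
    ENNReal.ofReal (1 / (32 * n)) ≤
      minimaxRisk d n (compDistr d q K dstar β r Λ ∩ noiseClass d ⊤ α τ) := by
  have hn0 : (0 : ℝ) < n := by exact_mod_cast hn
  have hn1 : (1 : ℝ) ≤ n := by exact_mod_cast hn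
  have hΛ0 : 0 < Λ := by linarith
  have ha0 : 0 < a := by rw [ha]; exact div_pos (by linarith) (by linarith)
  -- The choice of `a` makes `{x₀ ≥ 2a}` have volume exactly `1/Λ`.
  have h2a : 2 * a = 1 - 1 / Λ := by rw [ha]; field_simp
  have hinv : 0 < 1 / Λ := by positivity
  let j0 : Fin dstar := ⟨0, hs⟩
  let i0 : Fin d := Fin.castLEOrderEmb hd j0
  obtain ⟨-, h1, h2, -⟩ := hc r hr dstar j0
  have hH : ∀ σ : Unit → Bool, (fun x : Cube d => if σ () then (1 : ℝ) else transition a (x i0)) ∈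
      sparseHolder d dstar β r := fun σ => by
    cases h : σ ()
    · exact ⟨Fin.castLEOrderEmb hd, _, h1, fun x => by simp [i0]⟩
    · exact ⟨Fin.castLEOrderEmb hd, _, h2, fun x => by simp⟩
  have hw : (1 : ℝ) / (2 * n) ≤ a := by
    rw [div_le_iff₀ ha0] at han
    rw [div_le_iff₀ (by positivity)]; nlinarith
  -- One cell `{x₀ ≤ a}`, on which the label is deterministic: `e = 1/2` means margin `1`. The mass
  -- `1/(2n)` is the largest that leaves the bit undecided by the affinity criterion.
  have key := le_minimaxRisk_of_cells (ι := Unit) (q := q) (K := K) (e := 1 / 2)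
    (w := 1 / (2 * n)) (s := ⊤) hn hα hβ hΛ hατ hs hK (fun i => (hc r hr dstar i).1)
    (fun (σ : Unit → Bool) (x : Cube d) => if σ () then (1 : ℝ) else transition a (x i0)) hH
    (fun σ => measurable_of_mem_sparseHolder (hH σ))
    (fun σ x => by
      cases h : σ ()
      · simpa using transition_mem a (x i0)
      · simp)
    (fun _ => {x | (x i0 : ℝ) ∈ Set.Icc 0 a}) {x | (x i0 : ℝ) ∈ Set.Icc (2 * a) 1}
    (fun _ => measurableSet_coord_mem i0 0 a) (measurableSet_coord_mem i0 (2 * a) 1)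
    (fun i j hij => absurd (Subsingleton.elim i j) hij)
    (fun _ => Set.disjoint_left.2 fun x (hx : _ ∈ Set.Icc _ _) (hx' : _ ∈ Set.Icc _ _) => by
      linarith [hx.2, hx'.1])
    (fun σ i x hx => by
      have : transition a (x i0) = 0 := transition_of_le ha0 hx.2
      cases h : σ ()
      · simp [this, bitSign]
      · simp [bitSign]; norm_num)
    (fun σ x hx => by
      have : transition a (x i0) = 1 := transition_of_ge ha0 hx.1
      simp [this])
    (by norm_num) (by norm_num) (by positivity)
    (by
      rw [Fintype.card_unit, Nat.cast_one, one_mul, div_le_one (by positivity)]; linarith)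
    (fun _ => by
      rw [volume_real_coord_mem i0 0 a le_rfl ha0.le (by linarith)]
      nlinarith)
    (by
      rw [volume_real_coord_mem i0 (2 * a) 1 (by linarith) (by linarith) le_rfl, h2a]
      field_simp; linarith)
    (fun _ => by norm_num) (fun h => absurd rfl h)
    (by norm_num)
  refine le_trans (le_of_eq ?_) key
  congr 1
  norm_num
  field_simp
  norm_num

/-- Admissible heights of smooth bumps on `ℝ^m`. -/
def IsBumpHeight (m : ℕ) (β c : ℝ) : Prop :=
  ∃ (ψ : EuclideanSpace ℝ (Fin m) → ℝ) (B : ℝ), ContDiff ℝ ∞ ψ ∧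
    (∀ k ≤ ⌈β⌉₊, ∀ x, ‖iteratedFDeriv ℝ k ψ x‖ ≤ B) ∧ 2 * (c * B) ≤ 1 ∧
    (∀ x ∈ tsupport ψ, ‖x‖ ≤ 3 / 8) ∧ (∀ x, ‖x‖ ≤ 1 / 4 → ψ x = 1) ∧ ∀ x, |ψ x| ≤ 1

theorem exists_isBumpHeight (m : ℕ) (β : ℝ) : ∃ c, 0 < c ∧ 2 * c ≤ 1 ∧ IsBumpHeight m β c := by
  let ψ : ContDiffBump (0 : EuclideanSpace ℝ (Fin m)) :=
    ⟨1 / 4, 3 / 8, by norm_num, by norm_num⟩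
  obtain ⟨B, hB, h⟩ := exists_iteratedFDeriv_bound (f := ψ) ψ.contDiff ψ.hasCompactSupport ⌈β⌉₊
  -- With this height, `2cB = B/(B+1)` and `2c = 1/(B+1)` are both at most `1`.
  refine ⟨1 / (2 * (B + 1)), by positivity, ?_, ψ, B, ψ.contDiff, h, ?_, fun x hx => ?_,
    fun x hx => ψ.one_of_mem_closedBall ?_, fun x => ?_⟩
  · field_simp; linarith
  · field_simp; linarith
  · rw [ψ.tsupport_eq] at hx
    exact mem_closedBall_zero_iff.1 hx
  · exact mem_closedBall_zero_iff.2 hx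
  · rw [abs_of_nonneg ψ.nonneg]; exact ψ.le_one

/-! ### The grid of cells -/

/-- The lower corner, in units of the mesh, of a cell in the slab of `N` layers of cells. -/
def cellPos {N M k : ℕ} (j : Fin N × (Fin k → Fin M)) : Fin (k + 1) → ℕ :=
  Fin.cons (j.1 : ℕ) fun l => (j.2 l : ℕ)

theorem cellPos_injective {N M k : ℕ} :
    Function.Injective (cellPos : Fin N × (Fin k → Fin M) → Fin (k + 1) → ℕ) := by
  intro j j' h
  obtain ⟨h1, h2⟩ := Fin.cons_inj.1 h
  refine Prod.ext (Fin.ext h1) (funext fun l => Fin.ext ?_)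
  exact congrFun h2 l

theorem cellPos_zero_lt {N M k : ℕ} (j : Fin N × (Fin k → Fin M)) : cellPos j 0 < N := j.1.2

theorem cellPos_lt {N M k : ℕ} (hNM : N ≤ M) (j : Fin N × (Fin k → Fin M)) (i : Fin (k + 1)) :
    cellPos j i < M := by
  refine Fin.cases ?_ (fun l => ?_) i
  · exact (cellPos_zero_lt j).trans_le hNM
  · exact (j.2 l).2

/-- The centre of a cell, in units of the mesh. -/
noncomputable def cellCentre {N M k : ℕ} (j : Fin N × (Fin k → Fin M)) :
    EuclideanSpace ℝ (Fin (k + 1)) :=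
  WithLp.toLp 2 fun i => (cellPos j i : ℝ) + 1 / 2

/-- Distinct centres differ by at least `1` in some coordinate, whereas the two radii add up to only
`3/4`. -/
theorem cell_eq_of_norm_sub_le {N M k : ℕ} {j j' : Fin N × (Fin k → Fin M)}
    {y : EuclideanSpace ℝ (Fin (k + 1))} (h : ‖y - cellCentre j‖ ≤ 3 / 8)
    (h' : ‖y - cellCentre j'‖ ≤ 3 / 8) : j = j' := by
  refine cellPos_injective (funext fun i => ?_)
  have h1 := abs_le.1 ((PiLp.norm_apply_le (y - cellCentre j) i).trans h)
  have h2 := abs_le.1 ((PiLp.norm_apply_le (y - cellCentre j') i).trans h')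
  simp only [cellCentre, PiLp.sub_apply] at h1 h2
  have h3 : (cellPos j i : ℝ) < cellPos j' i + 1 := by linarith [h1.1, h1.2, h2.1, h2.2]
  have h4 : (cellPos j' i : ℝ) < cellPos j i + 1 := by linarith [h1.1, h1.2, h2.1, h2.2]
  have h5 : cellPos j i < cellPos j' i + 1 := by exact_mod_cast h3
  have h6 : cellPos j' i < cellPos j i + 1 := by exact_mod_cast h4
  omega

theorem abs_bitSign (b : Bool) : |bitSign b| = 1 := by cases b <;> simp [bitSign]

/-- The core of a cell, on which the bump is constant. -/
def cellCore {N M k : ℕ} (e : ℕ) (j : Fin N × (Fin k → Fin M)) : Set (Cube (k + 1 + e)) :=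
  {x | ∀ i, (x (Fin.castAdd e i) : ℝ) ∈ Set.Icc
    (((cellPos j i : ℝ) + 1 / 2 - 1 / (8 * (k + 1))) / M)
    (((cellPos j i : ℝ) + 1 / 2 + 1 / (8 * (k + 1))) / M)}

/-- The lower bound for a finite noise exponent in terms of the mesh `1/M`, the number `N` of layers
and the mass `w` of a cell. -/
theorem le_minimaxRisk_grid {k e q K n N M : ℕ} {α β r Λ a c c' w : ℝ} {τ s : ℝ≥0∞} (hn : 1 ≤ n)
    (hα : 0 < α) (hβ : 0 < β) (hΛ : 1 < Λ) (hατ : ¬ (α < 1 ∧ 1 ≤ τ))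
    (hK : (k + 1) * q ≤ K * q) (ha : a = (Λ - 1) / (2 * Λ)) (hc' : IsHolderConst β a c')
    (hr : c' ≤ r) (hc0 : 0 < c) (hc1 : 2 * c ≤ 1) (hc : IsBumpHeight (k + 1) β c)
    (hN : 1 ≤ N) (hNM : (N : ℝ) ≤ a * M) (hw : 0 < w)
    (hw1 : ((N * M ^ k : ℕ) : ℝ) * w ≤ 1) (hwΛ : w ≤ Λ * (1 / (4 * (k + 1) * M)) ^ (k + 1))
    (hst : s ≠ ⊤)
    (hsα : ((N * M ^ k : ℕ) : ℝ) * w ≤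
      α * ((2 * (c * (M : ℝ) ^ (-β))) ^ (min 1 β ^ q)) ^ s.toReal)
    (hwn : w * ((2 * (c * (M : ℝ) ^ (-β))) ^ (min 1 β ^ q)) ^ 2 ≤ 1 / (2 * n)) :
    ENNReal.ofReal (((N * M ^ k : ℕ) : ℝ) * w *
        (2 * (c * (M : ℝ) ^ (-β))) ^ (min 1 β ^ q) / 16) ≤
      minimaxRisk (k + 1 + e) n
        (compDistr (k + 1 + e) q K (k + 1) β r Λ ∩ noiseClass (k + 1 + e) s α τ) := by
  have hΛ0 : 0 < Λ := by linarith
  have ha0 : 0 < a := by rw [ha]; exact div_pos (by linarith) (by linarith)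
  have h2a : 2 * a = 1 - 1 / Λ := by rw [ha]; field_simp
  have hinv : 0 < 1 / Λ := by positivity
  have hN1 : (1 : ℝ) ≤ N := by exact_mod_cast hN
  have hM0 : (0 : ℝ) < M := by
    by_contra h
    nlinarith [not_lt.1 h]
  have hM1 : (1 : ℝ) ≤ M := by
    have : 0 < M := by exact_mod_cast hM0
    exact_mod_cast this
  have hNM' : N ≤ M := by
    have : (N : ℝ) ≤ M := by nlinarith
    exact_mod_cast this
  obtain ⟨ψ, Bψ, hψ, hψB, hcB, hψs, hψ1, hψle⟩ := hc
  obtain ⟨-, -, -, B, hBr, hT⟩ := hc' r hr (k + 1) 0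
  set h := c * (M : ℝ) ^ (-β) with hh
  have hMβ : 0 < (M : ℝ) ^ (-β) := Real.rpow_pos_of_pos hM0 _
  have hMβ1 : (M : ℝ) ^ (-β) ≤ 1 := Real.rpow_le_one_of_one_le_of_nonpos hM1 (by linarith)
  have h0 : 0 < h := mul_pos hc0 hMβ
  have h1 : 2 * h ≤ 1 := by nlinarith
  let ι := Fin N × (Fin k → Fin M)
  let S : (ι → Bool) → EuclideanSpace ℝ (Fin (k + 1)) → ℝ := fun σ x =>
    ∑ j, (c * (M : ℝ) ^ (-β) * bitSign (σ j)) * ψ ((M : ℝ) • x - cellCentre j)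
  have hsep : ∀ y (i j : ι), y - cellCentre i ∈ tsupport ψ → y - cellCentre j ∈ tsupport ψ →
      i = j := fun y i j hi hj => cell_eq_of_norm_sub_le (hψs _ hi) (hψs _ hj)
  have hS : ∀ σ, SmoothHolder (k + 1) β (S σ) (2 * (c * Bψ)) := fun σ =>
    smoothHolder_sum_bumps hβ hψ hM1 hc0.le hψB cellCentre (fun j => bitSign (σ j))
      (fun j => (abs_bitSign _).le) hsep
  have hψ0 : ∀ x, x ∉ tsupport ψ → ψ x = 0 := fun x hx =>
    Function.notMem_support.1 fun h => hx (subset_closure h)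
  have hSone : ∀ σ x (j : ι), (M : ℝ) • x - cellCentre j ∈ tsupport ψ →
      S σ x = h * bitSign (σ j) * ψ ((M : ℝ) • x - cellCentre j) := fun σ x j hj => by
    refine Finset.sum_eq_single j (fun i _ hij => ?_) fun hj => absurd (Finset.mem_univ j) hj
    rw [hψ0 _ fun hi => hij (hsep _ _ _ hi hj), mul_zero]
  have hSzero : ∀ σ x, (∀ j : ι, (M : ℝ) • x - cellCentre j ∉ tsupport ψ) → S σ x = 0 :=
    fun σ x hx => Finset.sum_eq_zero fun j _ => by rw [hψ0 _ (hx j), mul_zero]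
  have hSle : ∀ σ x, |S σ x| ≤ h := fun σ x => by
    by_cases hex : ∃ j : ι, (M : ℝ) • x - cellCentre j ∈ tsupport ψ
    · obtain ⟨j, hj⟩ := hex
      rw [hSone σ x j hj, abs_mul, abs_mul, abs_bitSign, abs_of_pos h0, mul_one]
      exact mul_le_of_le_one_right h0.le (hψle _)
    · rw [hSzero σ x (by simpa using hex), abs_zero]; exact h0.le
  -- All layers lie in `{x₀ ≤ N/M}` and `N/M ≤ a`, so the bumps are dead before the transition
  -- begins to rise.
  have hSright : ∀ σ (x : EuclideanSpace ℝ (Fin (k + 1))), a < x 0 → S σ x = 0 :=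
      fun σ x hx => by
    refine hSzero σ x fun j hj => ?_
    have h2 := abs_le.1 ((PiLp.norm_apply_le _ (0 : Fin (k + 1))).trans (hψs _ hj))
    simp only [cellCentre, PiLp.sub_apply, PiLp.smul_apply, smul_eq_mul] at h2
    have h3 : (cellPos j 0 : ℝ) + 1 ≤ N := by exact_mod_cast cellPos_zero_lt j
    nlinarith [h2.2, h2.1]
  let emb : Cube (k + 1 + e) → EuclideanSpace ℝ (Fin (k + 1)) := fun x =>
    WithLp.toLp 2 fun i => (x (Fin.castAdd e i) : ℝ)
  -- Equal to `1/2` plus bumps for `x₀ ≤ a`, and to `1` for `x₀ ≥ 2a`. Transition and bumps are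
  -- never active at the same point, which keeps the values in `[0,1]`.
  let H : (ι → Bool) → Cube (k + 1 + e) → ℝ := fun σ x =>
    1 / 2 + transition a (emb x 0) / 2 + S σ (emb x)
  have hH : ∀ σ, H σ ∈ sparseHolder (k + 1 + e) (k + 1) β r := fun σ => by
    refine ⟨Fin.castAddOrderEmb e, fun y : Cube (k + 1) => 1 / 2 + transition a (y 0) / 2 +
      S σ (WithLp.toLp 2 fun i => (y i : ℝ)), (hT.add (hS σ)).mem_holderBall (fun y => ?_)
        (by linarith), fun x => rfl⟩
    simp [cutoff_eq_one (y 0).2.1 (y 0).2.2]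
  -- The half-width `1/(8(k+1))` is small enough that the cubic core, seen in mesh units, fits in
  -- the Euclidean ball of radius `1/4` where the bump equals `1`.
  have hcore : ∀ (j : ι), ∀ x ∈ cellCore e j, ‖(M : ℝ) • emb x - cellCentre j‖ ≤ 1 / 4 ∧
      emb x 0 ≤ a := fun j x hx => by
    have hco : ∀ i, |M * (emb x i) - (cellPos j i + 1 / 2)| ≤ 1 / (8 * ((k : ℝ) + 1)) := fun i => by
      obtain ⟨h2, h3⟩ := hx i
      rw [div_le_iff₀ hM0] at h2
      rw [le_div_iff₀ hM0] at h3
      have e1 : emb x i = x (Fin.castAdd e i) := rfl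
      rw [e1, abs_le]
      constructor <;> linarith
    have hδ : 1 / (8 * ((k : ℝ) + 1)) ≤ 1 / 8 := by
      rw [div_le_div_iff₀ (by positivity) (by norm_num)]; nlinarith [Nat.cast_nonneg (α := ℝ) k]
    constructor
    · rw [EuclideanSpace.norm_eq]
      refine Real.sqrt_le_iff.2 ⟨by norm_num, ?_⟩
      calc ∑ i, ‖((M : ℝ) • emb x - cellCentre j) i‖ ^ 2
          ≤ ∑ _i : Fin (k + 1), (1 / (8 * ((k : ℝ) + 1))) ^ 2 := by
            refine Finset.sum_le_sum fun i _ => ?_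
            exact pow_le_pow_left₀ (norm_nonneg _) (hco i) 2
        _ = (1 / (8 * ((k : ℝ) + 1))) * (1 / 8) := by
            rw [Finset.sum_const, Finset.card_univ, Fintype.card_fin, nsmul_eq_mul]
            push_cast; field_simp
        _ ≤ (1 / 8) * (1 / 8) := by gcongr
        _ ≤ (1 / 4) ^ 2 := by norm_num
    · have h2 := abs_le.1 (hco 0)
      have h3 : (cellPos j 0 : ℝ) + 1 ≤ N := by exact_mod_cast cellPos_zero_lt j
      by_contra h4
      nlinarith [not_le.1 h4, h2.2]
  have hcoret : ∀ (j : ι), ∀ x ∈ cellCore e j, (M : ℝ) • emb x - cellCentre j ∈ tsupport ψ :=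
    fun j x hx => subset_closure (by
      rw [Function.mem_support, hψ1 _ (hcore j x hx).1]; exact one_ne_zero)
  have hcard : Fintype.card ι = N * M ^ k := by simp [ι]
  rw [← hcard] at hw1 hsα ⊢
  refine le_minimaxRisk_of_cells hn hα hβ hΛ hατ (Nat.le_add_left 1 k) hK
    (fun i => (hc' r hr (k + 1) i).1) H hH
    (fun σ => measurable_of_mem_sparseHolder (hH σ)) (fun σ x => ?_) (cellCore e)
    {x | (x (Fin.castAdd e 0) : ℝ) ∈ Set.Icc (2 * a) 1} (fun j => ?_)
    (measurableSet_coord_mem _ _ _) (fun i j hij => ?_) (fun j => ?_) (fun σ j x hx => ?_)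
    (fun σ x hx => ?_) h0 h1 hw hw1 (fun j => ?_) ?_ (fun h => absurd h hst) (fun _ => hsα) hwn
  · have ht := transition_mem a (emb x 0)
    have hs := abs_le.1 (hSle σ (emb x))
    change 1 / 2 + transition a (emb x 0) / 2 + S σ (emb x) ∈ Set.Icc (0 : ℝ) 1
    rcases le_or_gt (emb x 0) a with hx | hx
    · rw [transition_of_le ha0 hx]; constructor <;> linarith [hs.1, hs.2]
    · rw [hSright σ _ hx]; constructor <;> linarith [ht.1, ht.2]
  · have : cellCore e j = ⋂ i, {x : Cube (k + 1 + e) | (x (Fin.castAdd e i) : ℝ) ∈ Set.Icc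
        (((cellPos j i : ℝ) + 1 / 2 - 1 / (8 * (k + 1))) / M)
        (((cellPos j i : ℝ) + 1 / 2 + 1 / (8 * (k + 1))) / M)} := by
      ext x; simp [cellCore]
    rw [this]
    exact MeasurableSet.iInter fun i => measurableSet_coord_mem _ _ _
  · exact Set.disjoint_left.2 fun x hx hx' => hij (hsep _ _ _ (hcoret i x hx) (hcoret j x hx'))
  · refine Set.disjoint_left.2 fun x hx (hx' : _ ∈ Set.Icc _ _) => ?_
    have h2 := (hcore j x hx).2
    have h3 : 2 * a ≤ emb x 0 := hx'.1
    linarith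
  · change 1 / 2 + transition a (emb x 0) / 2 + S σ (emb x) = _
    rw [transition_of_le ha0 (hcore j x hx).2, hSone σ _ j (hcoret j x hx),
      hψ1 _ (hcore j x hx).1]
    ring
  · have h3 : 2 * a ≤ emb x 0 := hx.1
    change 1 / 2 + transition a (emb x 0) / 2 + S σ (emb x) = _
    rw [transition_of_ge ha0 h3, hSright σ _ (by linarith)]
    norm_num
  · have hk : (0 : ℝ) ≤ k := Nat.cast_nonneg k
    have hδ : 1 / (8 * ((k : ℝ) + 1)) ≤ 1 / 8 := by
      rw [div_le_div_iff₀ (by positivity) (by norm_num)]; linarith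
    have hvol := volume_real_box (e := e) (k := k + 1)
      (fun i => ((cellPos j i : ℝ) + 1 / 2 - 1 / (8 * (k + 1))) / M)
      (fun i => ((cellPos j i : ℝ) + 1 / 2 + 1 / (8 * (k + 1))) / M)
      (θ := 1 / (4 * (k + 1) * M)) (fun i => ?_) (fun i => ?_) (by positivity) (fun i => ?_)
    · change w ≤ Λ * volume.real {x : Cube (k + 1 + e) | _}
      rw [hvol]; exact hwΛ
    · have : (0 : ℝ) ≤ cellPos j i := Nat.cast_nonneg _
      exact div_nonneg (by linarith) hM0.le
    · have : (cellPos j i : ℝ) + 1 ≤ M := by exact_mod_cast cellPos_lt hNM' j i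
      rw [div_le_one hM0]; linarith
    · field_simp; ring
  · rw [volume_real_coord_mem _ (2 * a) 1 (by linarith) (by linarith) le_rfl, h2a]
    field_simp; linarith

end BinClass

/-! ### Choice of the mesh and the rate -/

namespace BinClass

/-- The denominator exponent `D` of the mesh width `n^{-1/D}`. -/
noncomputable def meshExponent (dstar : ℕ) (β : ℝ) (s : ℝ≥0∞) (q : ℕ) : ℝ :=
  dstar + β * min 1 β ^ q * (2 + s.toReal)

/-- The constant of the lower bound for a finite noise exponent and bumps of height `c`. -/
noncomputable def lowerConst (dstar : ℕ) (β : ℝ) (s : ℝ≥0∞) (q : ℕ) (c : ℝ) : ℝ :=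
  (1 / (4 * (dstar : ℝ))) ^ dstar * ((2 * c) ^ (min 1 β ^ q)) ^ (s.toReal + 1) *
    2 ^ (-(β * min 1 β ^ q * (s.toReal + 1))) / 16

/-- Multiply numerator and denominator by `s + 1`. -/
theorem rateExponent_eq {q dstar : ℕ} {β : ℝ} {s : ℝ≥0∞} (hβ : 0 < β) (hs : s ≠ ⊤) :
    rateExponent q dstar β s =
      β * min 1 β ^ q * (s.toReal + 1) / meshExponent dstar β s q := by
  have h1 : ((s + 1)⁻¹).toReal = 1 / (s.toReal + 1) := by
    rw [ENNReal.toReal_inv, ENNReal.toReal_add hs ENNReal.one_ne_top, ENNReal.toReal_one, one_div]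
  have hS : 0 ≤ s.toReal := ENNReal.toReal_nonneg
  have hb : 0 < β * min 1 β ^ q := mul_pos hβ (pow_pos (lt_min one_pos hβ) q)
  rw [rateExponent, h1, meshExponent]
  set b := β * min 1 β ^ q
  have hd : (0 : ℝ) ≤ dstar := Nat.cast_nonneg _
  have e : (dstar : ℝ) * (1 / (s.toReal + 1)) + (1 + 1 / (s.toReal + 1)) * b =
      (dstar + b * (2 + s.toReal)) / (s.toReal + 1) := by
    field_simp; ring
  rw [e, div_div_eq_mul_div]

theorem rateExponent_top {q dstar : ℕ} {β : ℝ} (hβ : 0 < β) : rateExponent q dstar β ⊤ = 1 := by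
  have hb : β * min 1 β ^ q ≠ 0 := (mul_pos hβ (pow_pos (lt_min one_pos hβ) q)).ne'
  simp [rateExponent, hb]

theorem meshExponent_pos {dstar q : ℕ} {β : ℝ} {s : ℝ≥0∞} (hβ : 0 < β) :
    0 < meshExponent dstar β s q := by
  have hb : 0 < β * min 1 β ^ q := mul_pos hβ (pow_pos (lt_min one_pos hβ) q)
  have hS : 0 ≤ s.toReal := ENNReal.toReal_nonneg
  unfold meshExponent
  positivity

/-- The lower bound for a finite noise exponent. -/
theorem le_minimaxRisk_finite {d q K dstar n : ℕ} {α β r Λ a c c' : ℝ} {τ s : ℝ≥0∞} (hn : 1 ≤ n)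
    (hα : 0 < α) (hβ : 0 < β) (hΛ : 1 < Λ) (hατ : ¬ (α < 1 ∧ 1 ≤ τ)) (hd1 : 1 ≤ dstar)
    (hd : dstar ≤ d) (hK : dstar * q ≤ K * q) (ha : a = (Λ - 1) / (2 * Λ))
    (hc' : IsHolderConst β a c') (hr : c' ≤ r) (hc0 : 0 < c) (hc1 : 2 * c ≤ 1)
    (hc : IsBumpHeight dstar β c) (hst : s ≠ ⊤)
    (han : (1 / a) ^ meshExponent dstar β s q ≤ n) :
    ENNReal.ofReal (min α ((Λ - 1) / (256 * Λ)) * lowerConst dstar β s q c *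
        (1 / (n : ℝ)) ^ rateExponent q dstar β s) ≤
      minimaxRisk d n (compDistr d q K dstar β r Λ ∩ noiseClass d s α τ) := by
  obtain ⟨k, rfl⟩ : ∃ k, dstar = k + 1 := ⟨dstar - 1, by omega⟩
  obtain ⟨e, rfl⟩ := Nat.exists_eq_add_of_le hd
  rw [rateExponent_eq hβ hst]
  have hD := meshExponent_pos (dstar := k + 1) (q := q) (s := s) hβ
  set D := meshExponent (k + 1) β s q with hDdef
  set p := min 1 β with hp
  have hp0 : 0 < p := lt_min one_pos hβ
  set b := β * p ^ q with hb
  have hb0 : 0 < b := mul_pos hβ (pow_pos hp0 q)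
  have hS0 : 0 ≤ s.toReal := ENNReal.toReal_nonneg
  set S := s.toReal with hS
  set κ := (Λ - 1) / (256 * Λ) with hκ
  have hΛ0 : 0 < Λ := by linarith
  have hκ0 : 0 < κ := div_pos (by linarith) (by linarith)
  have haκ : a = 128 * κ := by rw [ha, hκ]; field_simp; ring
  have hκ1 : κ ≤ 1 := by rw [hκ, div_le_one (by positivity)]; linarith
  have ha0 : 0 < a := by linarith
  set μ := min α κ with hμ
  have hμ0 : 0 < μ := lt_min hα hκ0
  have hμα : μ ≤ α := min_le_left _ _
  have hμκ : μ ≤ κ := min_le_right _ _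
  have hn0 : (0 : ℝ) < n := by exact_mod_cast hn
  have hn1 : (1 : ℝ) ≤ n := by exact_mod_cast hn
  -- The ideal inverse mesh. Rounding up costs at most a factor `2`, which reappears as the power of
  -- `2` in `lowerConst`; the sample size condition gives `ν ≥ 1/a`, hence at least one layer of
  -- cells.
  set ν := (n : ℝ) ^ (1 / D) with hν
  have hν1 : 1 ≤ ν := Real.one_le_rpow hn1 (by positivity)
  have hνa : 1 / a ≤ ν := by
    have := Real.rpow_le_rpow (by positivity) han (show 0 ≤ 1 / D by positivity)
    rwa [← Real.rpow_mul (by positivity), mul_one_div_cancel hD.ne', Real.rpow_one] at this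
  have hνD : ν ^ D = n := by
    rw [hν, ← Real.rpow_mul hn0.le, one_div_mul_cancel hD.ne', Real.rpow_one]
  set M := ⌈ν⌉₊ with hM
  have hνM : ν ≤ M := Nat.le_ceil ν
  have hMν : (M : ℝ) ≤ 2 * ν := by
    have := (Nat.ceil_lt_add_one (by linarith : (0 : ℝ) ≤ ν)).le
    linarith
  have hM1 : (1 : ℝ) ≤ M := hν1.trans hνM
  have hM0 : (0 : ℝ) < M := by linarith
  have haM : 1 ≤ a * M := by
    have := (div_le_iff₀ ha0).1 (hνa.trans hνM); linarith
  set N := ⌊a * M⌋₊ with hN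
  have hN1 : 1 ≤ N := Nat.le_floor (by exact_mod_cast haM)
  have hN1' : (1 : ℝ) ≤ N := by exact_mod_cast hN1
  have hNM : (N : ℝ) ≤ a * M := Nat.floor_le (by positivity)
  -- The floor of a number at least `1` is at least half of it, and `a = 128 κ`.
  have hNlow : 64 * κ * M ≤ N := by
    have := Nat.lt_floor_add_one (a * (M : ℝ))
    rw [← hN, haκ] at this
    nlinarith
  set ε := (2 * (c * (M : ℝ) ^ (-β))) ^ (p ^ q) with hε
  set C := (2 * c) ^ (p ^ q) with hC
  have hC0 : 0 < C := Real.rpow_pos_of_pos (by linarith) _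
  have hC1 : C ≤ 1 := Real.rpow_le_one (by linarith) hc1 (by positivity)
  have hεC : ε = C * (M : ℝ) ^ (-b) := by
    rw [hε, ← mul_assoc, Real.mul_rpow (by linarith) (Real.rpow_nonneg hM0.le _),
      ← Real.rpow_mul hM0.le, hb, neg_mul]
  have hMb : 0 < (M : ℝ) ^ (-b) := Real.rpow_pos_of_pos hM0 _
  have hε0 : 0 < ε := by rw [hεC]; positivity
  have hεM : ε ≤ (M : ℝ) ^ (-b) := by rw [hεC]; exact mul_le_of_le_one_left hMb.le hC1
  have hε1 : ε ≤ 1 := hεM.trans (Real.rpow_le_one_of_one_le_of_nonpos hM1 (by linarith))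
  have hεS0 : 0 < ε ^ S := Real.rpow_pos_of_pos hε0 _
  have hεS1 : ε ^ S ≤ 1 := Real.rpow_le_one hε0.le hε1 hS0
  -- The fraction of a grid cell's volume occupied by its core.
  set c0 := (1 / (4 * ((k + 1 : ℕ) : ℝ))) ^ (k + 1) with hc0def
  have hc00 : 0 < c0 := by positivity
  have hc01 : c0 ≤ 1 := by
    refine pow_le_one₀ (by positivity) ?_
    rw [div_le_one (by positivity)]; push_cast; nlinarith [Nat.cast_nonneg (α := ℝ) k]
  have hNk : 0 < ((N * M ^ k : ℕ) : ℝ) := by push_cast; positivity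
  -- The total cell mass is `c0 μ ε^S`: `μ ≤ α` serves the noise condition, `μ ≤ κ` makes up for the
  -- layers filling only a fraction of the cube, and `c0` meets the density bound on the cores.
  set w := c0 * μ * ε ^ S / ((N * M ^ k : ℕ) : ℝ) with hw
  have hw0 : 0 < w := by positivity
  have hNw : ((N * M ^ k : ℕ) : ℝ) * w = c0 * μ * ε ^ S := by
    rw [hw]; field_simp
  have hNwμ : c0 * μ * ε ^ S ≤ μ * ε ^ S := by
    rw [mul_assoc]; exact mul_le_of_le_one_left (by positivity) hc01
  have hwle : w ≤ c0 * ε ^ S / (64 * (M : ℝ) ^ (k + 1)) := by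
    rw [hw, div_le_div_iff₀ hNk (by positivity)]
    push_cast
    have h1 : 64 * μ * M ≤ N := le_trans (by gcongr) hNlow
    have h2 : 0 ≤ c0 * ε ^ S * (M : ℝ) ^ k := by positivity
    calc c0 * μ * ε ^ S * (64 * (M : ℝ) ^ (k + 1))
        = c0 * ε ^ S * (M : ℝ) ^ k * (64 * μ * M) := by ring
      _ ≤ c0 * ε ^ S * (M : ℝ) ^ k * N := mul_le_mul_of_nonneg_left h1 h2
      _ = _ := by ring
  have key := le_minimaxRisk_grid (e := e) (N := N) (M := M) (w := w) hn hα hβ hΛ hατ hK ha hc' hr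
    hc0 hc1 hc hN1 hNM hw0 ?_ ?_ hst ?_ ?_
  · refine le_trans (ENNReal.ofReal_le_ofReal ?_) key
    rw [hNw]
    have hrate : (1 / (n : ℝ)) ^ (b * (S + 1) / D) = ν ^ (-(b * (S + 1))) := by
      rw [one_div, Real.inv_rpow hn0.le, ← Real.rpow_neg hn0.le, hν, ← Real.rpow_mul hn0.le]
      congr 1; ring
    have hεlow : C ^ (S + 1) * (2 ^ (-(b * (S + 1))) * ν ^ (-(b * (S + 1)))) ≤ ε ^ S * ε := by
      rw [← Real.mul_rpow (by norm_num) (by linarith)]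
      calc C ^ (S + 1) * (2 * ν) ^ (-(b * (S + 1)))
          ≤ C ^ (S + 1) * (M : ℝ) ^ (-(b * (S + 1))) := by
            refine mul_le_mul_of_nonneg_left ?_ (by positivity)
            exact Real.rpow_le_rpow_of_nonpos hM0 hMν
              (neg_nonpos.2 (mul_nonneg hb0.le (by linarith)))
        _ = ε ^ (S + 1) := by
            rw [hεC, Real.mul_rpow hC0.le hMb.le, ← Real.rpow_mul hM0.le, neg_mul]
        _ = ε ^ S * ε := by rw [Real.rpow_add hε0, Real.rpow_one]
    rw [hrate, lowerConst]
    have h3 := mul_le_mul_of_nonneg_left hεlow (show 0 ≤ c0 * μ / 16 by positivity)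
    calc _ = c0 * μ / 16 * (C ^ (S + 1) * (2 ^ (-(b * (S + 1))) * ν ^ (-(b * (S + 1))))) := by
          ring
      _ ≤ c0 * μ / 16 * (ε ^ S * ε) := h3
      _ = _ := by ring
  · rw [hNw]
    calc _ ≤ μ * ε ^ S := hNwμ
      _ ≤ 1 * 1 := mul_le_mul (hμκ.trans hκ1) hεS1 hεS0.le zero_le_one
      _ = 1 := one_mul 1
  · have e1 : Λ * (1 / (4 * ((k : ℝ) + 1) * M)) ^ (k + 1) = Λ * (c0 / (M : ℝ) ^ (k + 1)) := by
      rw [hc0def, ← div_pow]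
      congr 2
      push_cast
      rw [div_div]
    rw [e1]
    calc w ≤ c0 * ε ^ S / (64 * (M : ℝ) ^ (k + 1)) := hwle
      _ ≤ c0 * 1 / (1 * (M : ℝ) ^ (k + 1)) := by gcongr; norm_num
      _ = 1 * (c0 / (M : ℝ) ^ (k + 1)) := by ring
      _ ≤ _ := by gcongr
  · rw [hNw]
    exact hNwμ.trans (mul_le_mul_of_nonneg_right hμα hεS0.le)
  -- The critical balance: `w ε²` is at most `M^(-dstar) M^(-b(2+S)) / 64 = M^(-D) / 64`, and `M^D ≥
  -- n`.
  · have h4 : ε ^ S * ε ^ 2 ≤ (M : ℝ) ^ (-(b * (2 + S))) := by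
      calc ε ^ S * ε ^ 2 = ε ^ (2 + S) := by
            rw [add_comm, Real.rpow_add hε0, Real.rpow_two]
        _ ≤ ((M : ℝ) ^ (-b)) ^ (2 + S) := Real.rpow_le_rpow hε0.le hεM (by linarith)
        _ = _ := by rw [← Real.rpow_mul hM0.le, neg_mul]
    have h5 : (M : ℝ) ^ D = (M : ℝ) ^ (k + 1) * (M : ℝ) ^ (b * (2 + S)) := by
      rw [hDdef, meshExponent, Real.rpow_add hM0, Real.rpow_natCast]
    have h6 : (n : ℝ) ≤ (M : ℝ) ^ D := by
      rw [← hνD]; exact Real.rpow_le_rpow (by linarith) hνM hD.le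
    calc w * ε ^ 2 ≤ c0 * ε ^ S / (64 * (M : ℝ) ^ (k + 1)) * ε ^ 2 := by gcongr
      _ = c0 * (ε ^ S * ε ^ 2) / (64 * (M : ℝ) ^ (k + 1)) := by ring
      _ ≤ 1 * (M : ℝ) ^ (-(b * (2 + S))) / (64 * (M : ℝ) ^ (k + 1)) := by gcongr
      _ = 1 / (64 * (M : ℝ) ^ D) := by
          rw [h5, Real.rpow_neg hM0.le]
          field_simp
      _ ≤ 1 / (2 * n) := by
          rw [div_le_div_iff₀ (by positivity) (by positivity)]
          linarith

end BinClass

/-! ### Assembly of the constants -/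

open BinClass
theorem theorem4p1 :
    ∃ (c₇ : (β Λ : ℝ) → ℝ)
      (c₈ : (dstar : ℕ) → (β : ℝ) → (s : ℝ≥0∞) → (q : ℕ) → ℝ)
      (c₉ : (dstar : ℕ) → (β : ℝ) → (s : ℝ≥0∞) → (q : ℕ) → (Λ : ℝ) → ℝ),
      ∀ (q d dstar K : ℕ) (α β Λ : ℝ) (τ s : ℝ≥0∞),
        1 ≤ d → 1 ≤ dstar → 1 ≤ K → 0 < α → 0 < τ → 0 < β → 1 < Λ →
        dstar * q ≤ K * q → dstar ≤ d → ¬ (α < 1 ∧ 1 ≤ τ) →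
        0 < c₇ β Λ ∧ 0 < c₈ dstar β s q ∧ 0 < c₉ dstar β s q Λ ∧
        ∀ (r : ℝ) (n : ℕ), c₇ β Λ ≤ r → 1 ≤ n → c₉ dstar β s q Λ < n →
          ENNReal.ofReal
            (max ((1 / 32 : ℝ) * (if s = ⊤ then 1 else 0))
                (min α ((Λ - 1) / (256 * Λ)) * c₈ dstar β s q) *
              (1 / (n : ℝ)) ^ rateExponent q dstar β s) ≤
          minimaxRisk d n (compDistr d q K dstar β r Λ ∩ noiseClass d s α τ) := by
  -- The constant must be a total function of `(β, Λ)`; for `β ≤ 0` an arbitrary value is taken.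
  have h7 : ∀ β Λ : ℝ, ∃ c, 0 < β → 0 < c ∧ IsHolderConst β ((Λ - 1) / (2 * Λ)) c := fun β Λ => by
    by_cases hβ : 0 < β
    · obtain ⟨c, hc⟩ := exists_isHolderConst hβ ((Λ - 1) / (2 * Λ))
      exact ⟨c, fun _ => hc⟩
    · exact ⟨0, fun h => absurd h hβ⟩
  choose c7 hc7 using h7
  choose c hc0 hc1 hc using exists_isBumpHeight
  refine ⟨c7, fun dstar β s q => if s = ⊤ then 1 else lowerConst dstar β s q (c dstar β),
    fun dstar β s q Λ => if s = ⊤ then 1 / ((Λ - 1) / (2 * Λ)) else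
      (1 / ((Λ - 1) / (2 * Λ))) ^ meshExponent dstar β s q,
    fun q d dstar K α β Λ τ s _ hds _ hα _ hβ hΛ hK hd hατ => ?_⟩
  have ha : 0 < (Λ - 1) / (2 * Λ) := div_pos (by linarith) (by linarith)
  have hκ : 0 < (Λ - 1) / (256 * Λ) := div_pos (by linarith) (by linarith)
  by_cases hs : s = ⊤
  · subst hs
    simp only [if_true]
    refine ⟨(hc7 β Λ hβ).1, one_pos, by positivity, fun r n hr hn hcn => ?_⟩
    -- At `s = ∞` the second entry of the maximum, with its constant set to `1`, is below `1/32`, so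
    -- only the single-cell bound is needed.
    have hκ' : (Λ - 1) / (256 * Λ) ≤ 1 / 32 := by
      rw [div_le_div_iff₀ (by linarith) (by norm_num)]; linarith
    rw [rateExponent_top hβ, Real.rpow_one, max_eq_left
      (by rw [mul_one, mul_one]; exact (min_le_right _ _).trans hκ')]
    have := le_minimaxRisk_top hn hα hβ hΛ hατ hds hd hK rfl (hc7 β Λ hβ).2 hr hcn.le
    refine le_trans (le_of_eq ?_) this
    congr 1
    have : (0 : ℝ) < n := by exact_mod_cast hn
    field_simp
  · simp only [if_neg hs]
    have hlow : 0 < lowerConst dstar β s q (c dstar β) := by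
      have h1 : 0 < 2 * c dstar β := by linarith [hc0 dstar β]
      have h2 : (0 : ℝ) < dstar := by exact_mod_cast hds
      have h3 := Real.rpow_pos_of_pos h1 (min 1 β ^ q)
      have h4 := Real.rpow_pos_of_pos h3 (s.toReal + 1)
      unfold lowerConst
      positivity
    refine ⟨(hc7 β Λ hβ).1, hlow, by positivity, fun r n hr hn hcn => ?_⟩
    have hmin : 0 < min α ((Λ - 1) / (256 * Λ)) := lt_min hα hκ
    rw [mul_zero, max_eq_right (by positivity)]
    exact le_minimaxRisk_finite hn hα hβ hΛ hατ hds hd hK rfl (hc7 β Λ hβ).2 hr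
      (hc0 dstar β) (hc1 dstar β) (hc dstar β) hs hcn.le
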